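/- Let $k$ be a field of characteristic zero. For a $\mathbb{Z}$-graded $k$-vector space $\mathcal{H}=\bigoplus_{i\in\mathbb{Z}}\mathcal{H}^i$ let $C(\mathcal{H})=\bigoplus_{n\ge 0}\mathcal{H}^{\otimes n}$ be the tensor coalgebra with the coproduct $\triangle(o_1\cdots o_n)=\sum_{j=0}^{n}(o_1\cdots o_j)\otimes(o_{j+1}\cdots o_n)$ and the counit given by the projection to $\mathcal{H}^{\otimes 0}=k$, graded by total degree. An $A_\infty$-algebra $(\mathcal{H},\mathfrak{m})$ is a graded vector space $\mathcal{H}$ with a linear map $\mathfrak{m}:C(\mathcal{H})\to C(\mathcal{H})$ of degree one that is a coderivation, $\triangle\mathfrak{m}=(\mathfrak{m}\otimes 1+1\otimes\mathfrak{m})\triangle$ with $(1\otimes\mathfrak{m})(x\otimes y)=(-1)^{\deg x}x\otimes\mathfrak{m}(y)$, and satisfies $\mathfrak{m}^2=0$ and $m_0=0$; here $m_n:\mathcal{H}^{\otimes n}\to\mathcal{H}$ is the $\mathcal{H}$-component of the restriction of $\mathfrak{m}$ to $\mathcal{H}^{\otimes n}$. An $A_\infty$-morphism $\mathcal{F}:(\mathcal{H},\mathfrak{m})\to(\mathcal{H}',\mathfrak{m}')$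 is a homomorphism of counital coalgebras $\mathcal{F}:C(\mathcal{H})\to C(\mathcal{H}')$ of degree zero with $\mathcal{F}\mathfrak{m}=\mathfrak{m}'\mathcal{F}$ and $f_0=0$, where $f_n:\mathcal{H}^{\otimes n}\to\mathcal{H}'$ is the $\mathcal{H}'$-component of the restriction of $\mathcal{F}$ to $\mathcal{H}^{\otimes n}$. Then $m_1^2=0$ and $f_1$ is a chain map $(\mathcal{H},m_1)\to(\mathcal{H}',m_1')$; $\mathcal{F}$ is an $A_\infty$-quasi-isomorphism if the induced map $H(f_1):H_{m_1}(\mathcal{H})\to H_{m_1'}(\mathcal{H}')$ on cohomology is an isomorphism. **Theorem (existence of the inverse quasi-isomorphism).** Let $(\mathcal{H},\mathfrak{m})$ and $(\mathcal{H}',\mathfrak{m}')$ be $A_\infty$-algebras over $k$ and let $\mathcal{F}:(\mathcal{H},\mathfrak{m})\to(\mathcal{H}',\mathfrak{m}')$ be an $A_\infty$-quasi-isomorphism. Then there exists an inverse $A_\infty$-quasi-isomorphism, that is, an $A_\infty$-quasi-isomorphism $\mathcal{G}:(\mathcal{H}',\mathfrak{m}')\to(\mathcal{H},\mathfrak{m})$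 such that $H(g_1)$ is the two-sided inverse of $H(f_1)$ on cohomology. -/

import Mathlib

open scoped TensorProduct

noncomputable section

namespace AInfty

section TensorCoalgebra

variable (k : Type*) [Field k] (H : Type*) [AddCommGroup H] [Module k H]

/-- The underlying space `⨁ n ≥ 0, H^{⊗ n}` of the tensor coalgebra of `H`.  Only its vector space
structure and the words `o₁ ⋯ oₙ` (products of letters `ι o`) are used; as a coalgebra it carries the
deconcatenation coproduct `deconc`. -/
abbrev Bar : Type _ := TensorAlgebra k H

/-- The operator `(w, d) ↦ (x w, 1 ⊗ x w + (x ⊗ 1) d)`, linear in `x : H`.  It encodes the recursion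
`Δ (x w) = 1 ⊗ x w + (x ⊗ 1) Δ w`. -/
def deconcStep :
    H →ₗ[k] Module.End k (Bar k H × (Bar k H ⊗[k] Bar k H)) where
  toFun x :=
    LinearMap.prod
      (LinearMap.mulLeft k (TensorAlgebra.ι k x) ∘ₗ LinearMap.fst k _ _)
      (TensorProduct.mk k (Bar k H) (Bar k H) 1 ∘ₗ
          LinearMap.mulLeft k (TensorAlgebra.ι k x) ∘ₗ LinearMap.fst k _ _ +
        LinearMap.rTensor (Bar k H) (LinearMap.mulLeft k (TensorAlgebra.ι k x)) ∘ₗ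
          LinearMap.snd k _ _)
  map_add' x y := by
    refine LinearMap.ext fun p => Prod.ext ?_ ?_
    · simp [add_mul]
    · simp only [map_add, LinearMap.prod_apply, Function.prod_apply, LinearMap.add_apply,
        LinearMap.comp_apply, LinearMap.fst_apply, LinearMap.snd_apply, LinearMap.mulLeft_apply,
        add_mul, Prod.snd_add, TensorProduct.mk_apply]
      rw [show LinearMap.mulLeft k (TensorAlgebra.ι k x + TensorAlgebra.ι k y) =
        LinearMap.mulLeft k (TensorAlgebra.ι k x) + LinearMap.mulLeft k (TensorAlgebra.ι k y) from
          LinearMap.ext fun w => by simp [add_mul], LinearMap.rTensor_add, LinearMap.add_apply]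
      abel
  map_smul' c x := by
    refine LinearMap.ext fun p => Prod.ext ?_ ?_
    · simp
    · simp only [map_smul, LinearMap.prod_apply, Function.prod_apply, LinearMap.add_apply,
        LinearMap.comp_apply, LinearMap.fst_apply, LinearMap.snd_apply, LinearMap.mulLeft_apply,
        LinearMap.smul_apply, Prod.smul_snd, smul_mul_assoc, TensorProduct.mk_apply,
        RingHom.id_apply, smul_add]
      rw [show LinearMap.mulLeft k (c • TensorAlgebra.ι k x) =
        c • LinearMap.mulLeft k (TensorAlgebra.ι k x) from
          LinearMap.ext fun w => by simp, LinearMap.rTensor_smul, LinearMap.smul_apply]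

/-- The deconcatenation coproduct
`Δ (o₁ ⋯ oₙ) = ∑_{j = 0}^{n} (o₁ ⋯ oⱼ) ⊗ (oⱼ₊₁ ⋯ oₙ)`; see `deconc_word`. -/
def deconc : Bar k H →ₗ[k] Bar k H ⊗[k] Bar k H :=
  LinearMap.snd k _ _ ∘ₗ LinearMap.applyₗ ((1 : Bar k H), (1 : Bar k H) ⊗ₜ[k] (1 : Bar k H)) ∘ₗ
    (TensorAlgebra.lift k (deconcStep k H)).toLinearMap

/-- The counit: the projection of `⨁ n ≥ 0, H^{⊗ n}` to `H^{⊗ 0} = k`. -/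
def counit : Bar k H →ₗ[k] k := (TensorAlgebra.algebraMapInv (R := k) (M := H)).toLinearMap

/-- The projection of `⨁ n ≥ 0, H^{⊗ n}` to `H^{⊗ 1} = H`. -/
def proj : Bar k H →ₗ[k] H := TensorAlgebra.ιInv

variable {k H}

theorem deconc_one : deconc k H 1 = 1 ⊗ₜ 1 := by
  simp [deconc]

theorem lift_deconcStep_fst (w : Bar k H) (p : Bar k H × (Bar k H ⊗[k] Bar k H)) :
    (TensorAlgebra.lift k (deconcStep k H) w p).1 = w * p.1 := by
  induction w using TensorAlgebra.induction generalizing p with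
  | algebraMap r => simp [Algebra.smul_def]
  | ι x => simp [deconcStep]
  | mul a b ha hb => simp [ha, hb, mul_assoc]
  | add a b ha hb => simp [ha, hb, add_mul]

theorem deconc_ι_mul (x : H) (w : Bar k H) :
    deconc k H (TensorAlgebra.ι k x * w) =
      1 ⊗ₜ (TensorAlgebra.ι k x * w) +
        LinearMap.rTensor (Bar k H) (LinearMap.mulLeft k (TensorAlgebra.ι k x)) (deconc k H w) := by
  have h := lift_deconcStep_fst w ((1 : Bar k H), (1 : Bar k H) ⊗ₜ[k] (1 : Bar k H))
  simp only [mul_one] at h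
  have step : ∀ p : Bar k H × (Bar k H ⊗[k] Bar k H), (deconcStep k H x p).2 =
      1 ⊗ₜ (TensorAlgebra.ι k x * p.1) +
        LinearMap.rTensor (Bar k H) (LinearMap.mulLeft k (TensorAlgebra.ι k x)) p.2 :=
    fun p => rfl
  simp only [deconc, LinearMap.comp_apply, AlgHom.toLinearMap_apply, map_mul,
    TensorAlgebra.lift_ι_apply, LinearMap.applyₗ_apply_apply, Module.End.mul_apply,
    LinearMap.snd_apply]
  rw [step, h]

/-- Deconcatenation of a word, in closed form. -/
theorem deconc_word (l : List H) :
    deconc k H (l.map (TensorAlgebra.ι k)).prod =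
      ∑ j ∈ Finset.range (l.length + 1),
        ((l.take j).map (TensorAlgebra.ι k)).prod ⊗ₜ[k] ((l.drop j).map (TensorAlgebra.ι k)).prod := by
  induction l with
  | nil => simp [deconc_one]
  | cons x l ih =>
    rw [List.map_cons, List.prod_cons, deconc_ι_mul, ih, List.length_cons,
      Finset.sum_range_succ' _ (l.length + 1), map_sum, add_comm]
    simp

theorem bar_induction {P : Bar k H → Prop} (one : P 1)
    (add : ∀ a b, P a → P b → P (a + b)) (smul : ∀ (c : k) a, P a → P (c • a))
    (mul : ∀ (x : H) a, P a → P (TensorAlgebra.ι k x * a)) (w : Bar k H) : P w := by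
  suffices h : ∀ w u : Bar k H, P u → P (w * u) by simpa using h w 1 one
  intro w
  induction w using TensorAlgebra.induction with
  | algebraMap r => intro u hu; rw [← Algebra.smul_def]; exact smul r u hu
  | ι x => intro u hu; exact mul x u hu
  | mul a b ha hb => intro u hu; rw [mul_assoc]; exact ha _ (hb _ hu)
  | add a b ha hb => intro u hu; rw [add_mul]; exact add _ _ (ha _ hu) (hb _ hu)

theorem proj_ι (x : H) : proj k H (TensorAlgebra.ι k x) = x := TensorAlgebra.ι_leftInverse x

theorem proj_one : proj k H 1 = 0 := by
  let _ : Module kᵐᵒᵖ H := Module.compHom _ ((RingHom.id k).fromOpposite mul_comm)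
  have _ : IsCentralScalar k H := ⟨fun r m => rfl⟩
  change (TensorAlgebra.toTrivSqZeroExt (1 : Bar k H)).snd = _
  rw [map_one, TrivSqZeroExt.snd_one]

theorem proj_ι_mul (x : H) (w : Bar k H) :
    proj k H (TensorAlgebra.ι k x * w) = counit k H w • x := by
  let _ : Module kᵐᵒᵖ H := Module.compHom _ ((RingHom.id k).fromOpposite mul_comm)
  have _ : IsCentralScalar k H := ⟨fun r m => rfl⟩
  have h : ∀ w : Bar k H, (TensorAlgebra.toTrivSqZeroExt w).fst = counit k H w := by
    intro w
    induction w using bar_induction with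
    | one => simp [counit]
    | add a b ha hb => simp [ha, hb]
    | smul c a ha => simp [ha]
    | mul x a ha => simp [counit, TensorAlgebra.algebraMapInv]
  change (TensorAlgebra.toTrivSqZeroExt (TensorAlgebra.ι k x * w)).snd = _
  rw [map_mul, TrivSqZeroExt.snd_mul, h, h]
  simp [counit, TensorAlgebra.algebraMapInv]

theorem counit_one : counit k H 1 = 1 := by simp [counit]

theorem counit_ι_mul (x : H) (w : Bar k H) : counit k H (TensorAlgebra.ι k x * w) = 0 := by
  simp [counit, TensorAlgebra.algebraMapInv]

/-- The left counit law `(ε ⊗ 1) Δ = 1`. -/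
theorem counit_deconc (w : Bar k H) :
    TensorProduct.lift (LinearMap.lsmul k (Bar k H) ∘ₗ counit k H) (deconc k H w) = w := by
  induction w using bar_induction with
  | one => simp [deconc_one, counit_one]
  | add a b ha hb => rw [map_add, map_add, ha, hb]
  | smul c a ha => rw [map_smul, map_smul, ha]
  | mul x a _ =>
    have h : ∀ t : Bar k H ⊗[k] Bar k H,
        TensorProduct.lift (LinearMap.lsmul k (Bar k H) ∘ₗ counit k H)
          (LinearMap.rTensor (Bar k H) (LinearMap.mulLeft k (TensorAlgebra.ι k x)) t) = 0 := by
      intro t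
      induction t using TensorProduct.induction_on with
      | zero => simp
      | tmul u v => simp [counit_ι_mul]
      | add s t hs ht => rw [map_add, map_add, hs, ht, add_zero]
    rw [deconc_ι_mul, map_add, h]
    simp [counit_one]

/-- Splitting off the first letter of a word and putting it back. -/
def firstLetter : Bar k H ⊗[k] Bar k H →ₗ[k] Bar k H :=
  TensorProduct.lift (LinearMap.mul k (Bar k H) ∘ₗ TensorAlgebra.ι k ∘ₗ proj k H)

theorem firstLetter_tmul (u v : Bar k H) :
    firstLetter (u ⊗ₜ v) = TensorAlgebra.ι k (proj k H u) * v := by simp [firstLetter]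

theorem firstLetter_deconc (w : Bar k H) :
    firstLetter (deconc k H w) = w - algebraMap k (Bar k H) (counit k H w) := by
  induction w using bar_induction with
  | one => simp [deconc_one, firstLetter_tmul, proj_one, counit_one]
  | add a b ha hb => rw [map_add, map_add, ha, hb, map_add, map_add]; abel
  | smul c a ha =>
    rw [map_smul, map_smul, ha, map_smul, smul_sub, smul_eq_mul, map_mul, Algebra.smul_def c
      (algebraMap k (Bar k H) _)]
  | mul x a _ =>
    have h : ∀ t : Bar k H ⊗[k] Bar k H,
        firstLetter (LinearMap.rTensor (Bar k H) (LinearMap.mulLeft k (TensorAlgebra.ι k x)) t) =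
          TensorAlgebra.ι k x *
            TensorProduct.lift (LinearMap.lsmul k (Bar k H) ∘ₗ counit k H) t := by
      intro t
      induction t using TensorProduct.induction_on with
      | zero => simp
      | tmul u v => simp [firstLetter_tmul, proj_ι_mul]
      | add s t hs ht => rw [map_add, map_add, hs, ht, map_add, mul_add]
    rw [deconc_ι_mul, map_add, h, counit_deconc, firstLetter_tmul, proj_one, counit_ι_mul]
    simp

theorem deconc_ι (x : H) :
    deconc k H (TensorAlgebra.ι k x) =
      1 ⊗ₜ TensorAlgebra.ι k x + TensorAlgebra.ι k x ⊗ₜ 1 := by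
  have h := deconc_ι_mul (k := k) x 1
  simpa [deconc_one] using h

/-- A primitive element of the tensor coalgebra is a letter. -/
theorem eq_ι_of_primitive {w : Bar k H} (hw : deconc k H w = w ⊗ₜ 1 + 1 ⊗ₜ w) :
    w = TensorAlgebra.ι k (proj k H w) := by
  have h := firstLetter_deconc w
  have h2 := counit_deconc w
  rw [hw, map_add, firstLetter_tmul, firstLetter_tmul, proj_one] at h
  rw [hw] at h2
  have h3 : algebraMap k (Bar k H) (counit k H w) = 0 := by
    simpa [counit_one, Algebra.smul_def] using h2
  rw [h3] at h
  simpa using h.symm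

end TensorCoalgebra

section Components

variable {k : Type*} [Field k] {H : Type*} [AddCommGroup H] [Module k H]
  {H' : Type*} [AddCommGroup H'] [Module k H']

/-- The multilinear map `φₙ : H^{⊗ n} → H'` carried by a linear map `φ` of tensor coalgebras: the
`H'`-component of the restriction of `φ` to `H^{⊗ n}`. -/
def component (φ : Bar k H →ₗ[k] Bar k H') (n : ℕ) :
    MultilinearMap k (fun _ : Fin n => H) H' :=
  (proj k H' ∘ₗ φ).compMultilinearMap (TensorAlgebra.tprod k H n)

/-- The component `φ₁ : H → H'`, as a linear map. -/
def linearPart (φ : Bar k H →ₗ[k] Bar k H') : H →ₗ[k] H' :=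
  proj k H' ∘ₗ φ ∘ₗ TensorAlgebra.ι k

theorem component_one (φ : Bar k H →ₗ[k] Bar k H') (v : Fin 1 → H) :
    component φ 1 v = linearPart φ (v 0) := by
  simp [component, linearPart, TensorAlgebra.tprod_apply]

theorem proj_one_of_component_zero {φ : Bar k H →ₗ[k] Bar k H'} (h : component φ 0 = 0) :
    proj k H' (φ 1) = 0 := by
  have := congrArg (fun f => f (0 : Fin 0 → H)) h
  simpa [component, TensorAlgebra.tprod_apply] using this

end Components

section Grading

variable {k : Type*} [Field k] {H : Type*} [AddCommGroup H] [Module k H]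
  (ℋ : ℤ → Submodule k H)

/-- The degree `d` part of the tensor coalgebra of the graded vector space `H = ⨁ i, ℋ i`, spanned by
the words `o₁ ⋯ oₙ` in homogeneous letters whose degrees add up to `d`. -/
def barDegree (d : ℤ) : Submodule k (Bar k H) :=
  Submodule.span k {w | ∃ l : List (Σ i, ℋ i),
    (l.map Sigma.fst).sum = d ∧ w = (l.map fun o => TensorAlgebra.ι k (o.2 : H)).prod}

variable [DirectSum.Decomposition ℋ]

/-- The linear map `o ↦ (-1)^{deg o} o` of `H`. -/
def letterSign : H →ₗ[k] H :=
  DirectSum.toModule k ℤ H (fun i => ((i.negOnePow : ℤ) : k) • (ℋ i).subtype) ∘ₗ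
    (DirectSum.decomposeLinearEquiv ℋ).toLinearMap

/-- The linear map `w ↦ (-1)^{deg w} w` of the tensor coalgebra. -/
def barSign : Bar k H →ₗ[k] Bar k H :=
  (TensorAlgebra.lift k (TensorAlgebra.ι k ∘ₗ letterSign ℋ)).toLinearMap

theorem letterSign_apply {i : ℤ} {x : H} (hx : x ∈ ℋ i) :
    letterSign ℋ x = ((i.negOnePow : ℤ) : k) • x := by
  simp [letterSign, DirectSum.decomposeLinearEquiv_apply, DirectSum.decompose_of_mem ℋ hx,
    ← DirectSum.lof_eq_of k]

theorem barSign_apply {d : ℤ} {w : Bar k H} (hw : w ∈ barDegree ℋ d) :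
    barSign ℋ w = ((d.negOnePow : ℤ) : k) • w := by
  induction hw using Submodule.span_induction with
  | mem w hw =>
    obtain ⟨l, rfl, rfl⟩ := hw
    induction l with
    | nil => simp [barSign]
    | cons o l ih =>
      simp only [barSign, AlgHom.toLinearMap_apply] at ih
      simp only [barSign, AlgHom.toLinearMap_apply, List.map_cons, List.prod_cons, map_mul, ih,
        TensorAlgebra.lift_ι_apply, LinearMap.comp_apply, letterSign_apply ℋ o.2.2, List.sum_cons, Int.negOnePow_add,
        map_smul]
      rw [smul_mul_smul_comm]
      simp
  | zero => simp
  | add a b _ _ ha hb => simp [ha, hb]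
  | smul c a _ ha => rw [map_smul, ha, smul_comm]

end Grading

section Definitions

variable {k : Type*} [Field k] {H : Type*} [AddCommGroup H] [Module k H]
  {H' : Type*} [AddCommGroup H'] [Module k H']

/-- An `A∞`-structure on the graded vector space `H = ⨁ i, ℋ i`: a coderivation `𝔪` of degree one on
the tensor coalgebra with `𝔪² = 0` and `m₀ = 0`.  The coderivation rule is
`Δ 𝔪 = (𝔪 ⊗ 1) Δ + (1 ⊗ 𝔪) Δ` with `(1 ⊗ 𝔪) (x ⊗ y) = (-1)^{deg x} x ⊗ 𝔪 y`. -/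
structure AInftyAlgebra (ℋ : ℤ → Submodule k H) [DirectSum.Decomposition ℋ] where
  m : Bar k H →ₗ[k] Bar k H
  degree_one : ∀ d : ℤ, ∀ w ∈ barDegree ℋ d, m w ∈ barDegree ℋ (d + 1)
  coderivation : deconc k H ∘ₗ m =
    TensorProduct.map m LinearMap.id ∘ₗ deconc k H +
      TensorProduct.map (barSign ℋ) m ∘ₗ deconc k H
  sq_zero : m ∘ₗ m = 0
  m_zero : component m 0 = 0

variable {ℋ : ℤ → Submodule k H} [DirectSum.Decomposition ℋ]
  {ℋ' : ℤ → Submodule k H'} [DirectSum.Decomposition ℋ']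

/-- An `A∞`-morphism: a degree zero homomorphism `F` of (counital) tensor coalgebras with
`F 𝔪 = 𝔪' F` and `f₀ = 0`. -/
structure AInftyMorphism (A : AInftyAlgebra ℋ) (A' : AInftyAlgebra ℋ') where
  F : Bar k H →ₗ[k] Bar k H'
  degree_zero : ∀ d : ℤ, ∀ w ∈ barDegree ℋ d, F w ∈ barDegree ℋ' d
  comul_comp : deconc k H' ∘ₗ F = TensorProduct.map F F ∘ₗ deconc k H
  counit_comp : AInfty.counit k H' ∘ₗ F = counit k H
  comm : F ∘ₗ A.m = A'.m ∘ₗ F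
  f_zero : component F 0 = 0

namespace AInftyAlgebra

variable (A : AInftyAlgebra ℋ)

/-- The differential `m₁ : H → H`. -/
def m₁ : H →ₗ[k] H := linearPart A.m

theorem m_one : A.m 1 = 0 := by
  have h := LinearMap.congr_fun A.coderivation 1
  have h1 : barSign ℋ (1 : Bar k H) = 1 := by simp [barSign]
  simp only [LinearMap.comp_apply, LinearMap.add_apply, deconc_one, TensorProduct.map_tmul,
    LinearMap.id_apply, h1] at h
  rw [eq_ι_of_primitive h, proj_one_of_component_zero A.m_zero, map_zero]

theorem m_ι (x : H) : A.m (TensorAlgebra.ι k x) = TensorAlgebra.ι k (A.m₁ x) := by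
  refine eq_ι_of_primitive ?_
  have h := LinearMap.congr_fun A.coderivation (TensorAlgebra.ι k x)
  have h1 : barSign ℋ (1 : Bar k H) = 1 := by simp [barSign]
  simpa [deconc_ι, h1, m_one] using h

theorem m₁_m₁ (x : H) : A.m₁ (A.m₁ x) = 0 := by
  have h := LinearMap.congr_fun A.sq_zero (TensorAlgebra.ι k x)
  rw [LinearMap.comp_apply, m_ι, m_ι] at h
  simpa using h

/-- The cohomology `ker m₁ / im m₁` of the complex `(H, m₁)`. -/
abbrev Cohomology : Type _ :=
  LinearMap.ker A.m₁ ⧸ (LinearMap.range A.m₁).submoduleOf (LinearMap.ker A.m₁)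

end AInftyAlgebra

namespace AInftyMorphism

variable {A : AInftyAlgebra ℋ} {A' : AInftyAlgebra ℋ'} (F : AInftyMorphism A A')

/-- The linear map `f₁ : H → H'`. -/
def f₁ : H →ₗ[k] H' := linearPart F.F

theorem F_one : F.F 1 = 1 := by
  have h := LinearMap.congr_fun F.comul_comp 1
  have hc := LinearMap.congr_fun F.counit_comp 1
  have h2 := firstLetter_deconc (F.F 1)
  simp only [LinearMap.comp_apply, deconc_one, TensorProduct.map_tmul] at h
  rw [LinearMap.comp_apply, counit_one] at hc
  rw [h, firstLetter_tmul, proj_one_of_component_zero F.f_zero, hc, map_zero, zero_mul,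
    (algebraMap k (Bar k H')).map_one] at h2
  exact (sub_eq_zero.mp h2.symm)

theorem F_ι (x : H) : F.F (TensorAlgebra.ι k x) = TensorAlgebra.ι k (F.f₁ x) := by
  refine eq_ι_of_primitive ?_
  have h := LinearMap.congr_fun F.comul_comp (TensorAlgebra.ι k x)
  simpa [deconc_ι, F_one, add_comm] using h

/-- `f₁` is a chain map. -/
theorem f₁_m₁ (x : H) : F.f₁ (A.m₁ x) = A'.m₁ (F.f₁ x) := by
  have h := LinearMap.congr_fun F.comm (TensorAlgebra.ι k x)
  rw [LinearMap.comp_apply, LinearMap.comp_apply, A.m_ι, F_ι, F_ι, A'.m_ι] at h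
  exact (TensorAlgebra.ι_inj k _ _).mp h

/-- The restriction of `f₁` to cocycles. -/
def cocycleMap : LinearMap.ker A.m₁ →ₗ[k] LinearMap.ker A'.m₁ :=
  F.f₁.restrict fun x hx => by
    rw [LinearMap.mem_ker] at hx ⊢
    rw [← f₁_m₁, hx, map_zero]

/-- The map induced by `f₁` on cohomology. -/
def cohomologyMap : A.Cohomology →ₗ[k] A'.Cohomology :=
  Submodule.mapQ _ _ F.cocycleMap <| by
    rintro ⟨x, hx⟩ ⟨y, hy⟩
    exact ⟨F.f₁ y, by rw [← f₁_m₁, hy]; rfl⟩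

/-- `F` is an `A∞`-quasi-isomorphism: `f₁` induces an isomorphism on cohomology. -/
def IsQuasiIso : Prop := Function.Bijective F.cohomologyMap

end AInftyMorphism

end Definitions

end AInfty

end

/-! A coalgebra map into a tensor coalgebra is determined by its letter component, which may be
prescribed freely; the same holds for a `(K, 1)`-coderivation, the shape of a homotopy from the
identity to `K`. So the inverse `G` and a homotopy `T` from the identity to `F ∘ G` can be built
together, by induction on word length.

Suppose `G` and `T` satisfy `m G = G m'` and `F G - 1 = m' T + T m'` on words of length `< n`. On
words of length `n` both defects are primitive, hence letters, and give maps `ε` to `H` and `π` to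
`H'`. The relations `m² = 0`, `m'² = 0` and `F m = m' F` say that `(ε, π)` is a cocycle with values
in the mapping cone of `f₁`. Since `f₁` is a quasi-isomorphism, the cone is acyclic, and over a
field it has a contraction, which can be chosen homogeneous. Applying it to `(ε, π)` gives the
corrections to the letters of `G` and `T` that remove both defects in length `n` and change nothing
in smaller length. Carrying `T` along is what makes the obstruction cone-valued and therefore always
removable.

The corrections stabilize on every word, so a limit exists. On letters the homotopy gives `H(f₁)
H(g₁) = 1`; as `H(f₁)` is bijective, `H(g₁)` is its two-sided inverse.

The carrying lemmas are `deconc_ofBlocks` (free construction), `exists_cone_contraction`,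
`IsInverseUpTo.exists_succ` (one correction) and `exists_homotopy_inverse` (the limit). -/

open scoped TensorProduct

noncomputable section

namespace AInfty

/-! ### Cofree constructions: maps of tensor coalgebras from letter components. -/

section BlockRecursion

variable {k : Type*} [Field k] {H : Type*} [AddCommGroup H] [Module k H]
  {H' : Type*} [AddCommGroup H'] [Module k H']

/-- One step of the right-to-left construction of a map `X` of tensor coalgebras from its blocks
`a, b : Bar k H → H'`: the state is a pair `(w, C)` with
`C u = ∑_{w = w₁ w₂} (a (u w₁) X w₂ + b (u w₁) Y w₂)`. -/
def blockStep (a b : Bar k H →ₗ[k] H') (Y : Bar k H →ₗ[k] Bar k H') :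
    H →ₗ[k] Module.End k (Bar k H × (Bar k H →ₗ[k] Bar k H')) :=
  LinearMap.mk₂ k
    -- Lifting to endomorphisms of a state space replaces recursion on words. The first block of a
    -- word may end after any letter, so the state is a function of the prefix `u` of the block
    -- still open.
    (fun x p => (TensorAlgebra.ι k x * p.1,
      p.2 ∘ₗ LinearMap.mulRight k (TensorAlgebra.ι k x) +
        LinearMap.mulRight k (p.2 (TensorAlgebra.ι k x)) ∘ₗ TensorAlgebra.ι k ∘ₗ a +
        LinearMap.mulRight k (Y (TensorAlgebra.ι k x * p.1)) ∘ₗ TensorAlgebra.ι k ∘ₗ b))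
    (fun x y p => by
      refine Prod.ext (by simp [add_mul]) (LinearMap.ext fun u => ?_)
      simp [mul_add, add_mul]
      abel)
    (fun c x p => by
      refine Prod.ext (by simp) (LinearMap.ext fun u => ?_)
      simp)
    (fun x p q => by
      refine Prod.ext (by simp [mul_add]) (LinearMap.ext fun u => ?_)
      simp [mul_add]
      abel)
    (fun c x p => by
      refine Prod.ext (by simp) (LinearMap.ext fun u => ?_)
      simp)

/-- The pending-block map `w ↦ (u ↦ ∑_{w = w₁ w₂} (a (u w₁) X w₂ + b (u w₁) Y w₂))`. -/
def pendingBlock (a b : Bar k H →ₗ[k] H') (Y : Bar k H →ₗ[k] Bar k H') (r : k) :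
    Bar k H →ₗ[k] Bar k H →ₗ[k] Bar k H' :=
  LinearMap.snd k _ _ ∘ₗ LinearMap.applyₗ ((1 : Bar k H),
      r • (TensorAlgebra.ι k ∘ₗ a) + LinearMap.mulRight k (Y 1) ∘ₗ TensorAlgebra.ι k ∘ₗ b) ∘ₗ
    (TensorAlgebra.lift k (blockStep a b Y)).toLinearMap

/-- The map `X` with `X 1 = r` and
`X w = ∑_{w = w₁ w₂} (a w₁ X w₂ + b w₁ Y w₂)` on nonempty words `w`. -/
def ofBlocks (a b : Bar k H →ₗ[k] H') (Y : Bar k H →ₗ[k] Bar k H') (r : k) :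
    Bar k H →ₗ[k] Bar k H' :=
  r • (Algebra.linearMap k (Bar k H') ∘ₗ counit k H) + (pendingBlock a b Y r).flip 1

variable (a b : Bar k H →ₗ[k] H') (Y : Bar k H →ₗ[k] Bar k H') (r : k)

theorem lift_blockStep_fst (w : Bar k H) (p : Bar k H × (Bar k H →ₗ[k] Bar k H')) :
    (TensorAlgebra.lift k (blockStep a b Y) w p).1 = w * p.1 := by
  induction w using TensorAlgebra.induction generalizing p with
  | algebraMap r => simp [Algebra.smul_def]
  | ι x => simp [blockStep]
  | mul a b ha hb => simp [ha, hb, mul_assoc]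
  | add a b ha hb => simp [ha, hb, add_mul]

theorem pendingBlock_one (u : Bar k H) :
    pendingBlock a b Y r 1 u =
      r • TensorAlgebra.ι k (a u) + TensorAlgebra.ι k (b u) * Y 1 := by
  simp [pendingBlock]

/-- Three cases: `x` joins the open block `u`; or `u` is closed by `a` and a new block opens at `x`;
or `u` is closed by `b` and `Y` takes the whole remainder. -/
theorem pendingBlock_ι_mul (x : H) (w u : Bar k H) :
    pendingBlock a b Y r (TensorAlgebra.ι k x * w) u =
      pendingBlock a b Y r w (u * TensorAlgebra.ι k x) +
        TensorAlgebra.ι k (a u) * pendingBlock a b Y r w (TensorAlgebra.ι k x) +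
        TensorAlgebra.ι k (b u) * Y (TensorAlgebra.ι k x * w) := by
  have step : ∀ p : Bar k H × (Bar k H →ₗ[k] Bar k H'), (blockStep a b Y x p).2 u =
      p.2 (u * TensorAlgebra.ι k x) + TensorAlgebra.ι k (a u) * p.2 (TensorAlgebra.ι k x) +
        TensorAlgebra.ι k (b u) * Y (TensorAlgebra.ι k x * p.1) :=
    fun p => rfl
  simp only [pendingBlock, LinearMap.comp_apply, AlgHom.toLinearMap_apply, map_mul,
    TensorAlgebra.lift_ι_apply, LinearMap.applyₗ_apply_apply, Module.End.mul_apply,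
    LinearMap.snd_apply]
  rw [step, lift_blockStep_fst, mul_one]

variable {a b}

theorem ofBlocks_one (ha : a 1 = 0) (hb : b 1 = 0) :
    ofBlocks a b Y r 1 = algebraMap k _ r := by
  simp [ofBlocks, pendingBlock_one, ha, hb, counit_one, Algebra.smul_def]

theorem ofBlocks_ι_mul (ha : a 1 = 0) (hb : b 1 = 0) (x : H) (w : Bar k H) :
    ofBlocks a b Y r (TensorAlgebra.ι k x * w) = pendingBlock a b Y r w (TensorAlgebra.ι k x) := by
  simp [ofBlocks, pendingBlock_ι_mul, ha, hb, counit_ι_mul]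

theorem counit_pendingBlock (w u : Bar k H) : counit k H' (pendingBlock a b Y r w u) = 0 := by
  induction w using bar_induction generalizing u with
  | one =>
    have h := counit_ι_mul (k := k) (a u) 1
    rw [mul_one] at h
    simp [pendingBlock_one, counit_ι_mul, h]
  | add v w hv hw => simp [hv, hw]
  | smul c w hw => simp [hw]
  | mul x w hw => simp [pendingBlock_ι_mul, hw, counit_ι_mul]

theorem counit_ofBlocks (w : Bar k H) : counit k H' (ofBlocks a b Y r w) = r * counit k H w := by
  simp [ofBlocks, counit_pendingBlock]
  simp [counit]

/-- The map `w ↦ ∑_{w = w₁ w₂} a (u w₁) V w₂`. -/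
def headBlock (a : Bar k H →ₗ[k] H') (V : Bar k H →ₗ[k] Bar k H') (u : Bar k H) :
    Bar k H →ₗ[k] Bar k H' :=
  LinearMap.mul' k (Bar k H') ∘ₗ
    TensorProduct.map (TensorAlgebra.ι k ∘ₗ a ∘ₗ LinearMap.mulLeft k u) V ∘ₗ deconc k H

theorem headBlock_one (V : Bar k H →ₗ[k] Bar k H') (u : Bar k H) :
    headBlock a V u 1 = TensorAlgebra.ι k (a u) * V 1 := by
  simp [headBlock, deconc_one]

theorem headBlock_ι_mul (V : Bar k H →ₗ[k] Bar k H') (u w : Bar k H) (x : H) :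
    headBlock a V u (TensorAlgebra.ι k x * w) =
      TensorAlgebra.ι k (a u) * V (TensorAlgebra.ι k x * w) +
        headBlock a V (u * TensorAlgebra.ι k x) w := by
  simp only [headBlock, LinearMap.comp_apply, deconc_ι_mul, map_add, TensorProduct.map_tmul,
    LinearMap.mul'_apply, LinearMap.mulLeft_apply, mul_one]
  congr 2
  induction deconc k H w using TensorProduct.induction_on with
  | zero => simp
  | tmul p q => simp
  | add s t hs ht => simp only [map_add, hs, ht]

/-- A coalgebra map is recovered from its letter component. -/
theorem eq_headBlock_of_comul {V : Bar k H →ₗ[k] Bar k H'}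
    (hV : deconc k H' ∘ₗ V = TensorProduct.map V V ∘ₗ deconc k H)
    (hc : counit k H' ∘ₗ V = counit k H) (h1 : proj k H' (V 1) = 0) (x : H) (w : Bar k H) :
    V (TensorAlgebra.ι k x * w) =
      headBlock (proj k H' ∘ₗ V) V (TensorAlgebra.ι k x) w := by
  have h := firstLetter_deconc (V (TensorAlgebra.ι k x * w))
  have h2 := LinearMap.congr_fun hV (TensorAlgebra.ι k x * w)
  have h3 := LinearMap.congr_fun hc (TensorAlgebra.ι k x * w)
  simp only [LinearMap.comp_apply] at h2 h3
  rw [h2, h3, counit_ι_mul, map_zero, sub_zero, deconc_ι_mul, map_add, map_add,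
    TensorProduct.map_tmul, firstLetter_tmul, h1, map_zero, zero_mul, zero_add] at h
  rw [← h]
  simp only [headBlock, LinearMap.comp_apply]
  induction deconc k H w using TensorProduct.induction_on with
  | zero => simp
  | tmul p q => simp [firstLetter_tmul]
  | add s t hs ht => simp only [map_add, hs, ht]

theorem map_rTensor_apply {M N P Q R : Type*} [AddCommGroup M] [Module k M] [AddCommGroup N]
    [Module k N] [AddCommGroup P] [Module k P] [AddCommGroup Q] [Module k Q]
    [AddCommGroup R] [Module k R]
    (f : M →ₗ[k] N) (g : P →ₗ[k] Q) (h : R →ₗ[k] M) (z : R ⊗[k] P) :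
    TensorProduct.map f g (LinearMap.rTensor P h z) = TensorProduct.map (f ∘ₗ h) g z := by
  rw [LinearMap.rTensor, ← LinearMap.comp_apply, ← TensorProduct.map_comp, LinearMap.comp_id]

theorem rTensor_map_apply {M N P Q R : Type*} [AddCommGroup M] [Module k M] [AddCommGroup N]
    [Module k N] [AddCommGroup P] [Module k P] [AddCommGroup Q] [Module k Q]
    [AddCommGroup R] [Module k R]
    (f : M →ₗ[k] N) (g : P →ₗ[k] Q) (h : N →ₗ[k] R) (z : M ⊗[k] P) :
    LinearMap.rTensor Q h (TensorProduct.map f g z) = TensorProduct.map (h ∘ₗ f) g z := by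
  rw [LinearMap.rTensor, ← LinearMap.comp_apply, ← TensorProduct.map_comp, LinearMap.id_comp]

/-- The coproduct of a map built from blocks: if `V` is built from the blocks `a` then
`Δ X = (V ⊗ X + X ⊗ Y) Δ`. -/
theorem deconc_ofBlocks (ha : a 1 = 0) (hb : b 1 = 0) {Y V : Bar k H →ₗ[k] Bar k H'} {r : k}
    (hY : deconc k H' ∘ₗ Y = TensorProduct.map Y Y ∘ₗ deconc k H)
    (hr : r • Y = 0) (hV1 : V 1 = 1)
    (hV : ∀ x w, V (TensorAlgebra.ι k x * w) = headBlock a V (TensorAlgebra.ι k x) w) :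
    deconc k H' ∘ₗ ofBlocks a b Y r =
      TensorProduct.map V (ofBlocks a b Y r) ∘ₗ deconc k H +
        TensorProduct.map (ofBlocks a b Y r) Y ∘ₗ deconc k H := by
  set X := ofBlocks a b Y r with hX
  set C := pendingBlock a b Y r with hC
  have hY' (w) := LinearMap.congr_fun hY w
  simp only [LinearMap.comp_apply] at hY'
  have hX1 : X 1 = algebraMap k _ r := ofBlocks_one Y r ha hb
  have hXx (x w) : X (TensorAlgebra.ι k x * w) = C w (TensorAlgebra.ι k x) :=
    ofBlocks_ι_mul Y r ha hb x w
  -- The empty word contributes stray terms `r • v ⊗ Y w`. The hypothesis `hr` kills them in both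
  -- applications: `Y = 0` for coalgebra maps, `r = 0` for coderivations.
  have hXY (w) : X 1 ⊗ₜ[k] Y w = 0 := by
    have := LinearMap.congr_fun hr w
    rw [hX1, Algebra.algebraMap_eq_smul_one, TensorProduct.smul_tmul]
    rw [LinearMap.smul_apply, LinearMap.zero_apply] at this
    rw [this, TensorProduct.tmul_zero]
  have hrY (v : Bar k H') (w) : r • v ⊗ₜ[k] Y w = 0 := by
    have := LinearMap.congr_fun hr w
    rw [LinearMap.smul_apply, LinearMap.zero_apply] at this
    rw [← TensorProduct.tmul_smul, this, TensorProduct.tmul_zero]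
  have hC1 (u) : C 1 u = r • TensorAlgebra.ι k (a u) + TensorAlgebra.ι k (b u) * Y 1 :=
    pendingBlock_one a b Y r u
  have hCι (x w u) : C (TensorAlgebra.ι k x * w) u = C w (u * TensorAlgebra.ι k x) +
      TensorAlgebra.ι k (a u) * C w (TensorAlgebra.ι k x) +
        TensorAlgebra.ι k (b u) * Y (TensorAlgebra.ι k x * w) :=
    pendingBlock_ι_mul a b Y r x w u
  clear_value C X
  have hVx (x : H) : V ∘ₗ LinearMap.mulLeft k (TensorAlgebra.ι k x) =
      headBlock a V (TensorAlgebra.ι k x) := LinearMap.ext fun w => hV x w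
  have hXx' (x : H) : X ∘ₗ LinearMap.mulLeft k (TensorAlgebra.ι k x) =
      C.flip (TensorAlgebra.ι k x) := LinearMap.ext fun w => hXx x w
  -- The induction must run over all open prefixes `u`, since a new letter changes `u`. The case `u
  -- = x` is the claim for the word `x w`.
  have key : ∀ w : Bar k H, (∀ u, deconc k H' (C w u) = 1 ⊗ₜ C w u +
      TensorProduct.map (headBlock a V u) X (deconc k H w) +
        TensorProduct.map (C.flip u) Y (deconc k H w)) := by
    intro w
    induction w using bar_induction with
    | one =>
      intro u
      simp only [deconc_one, TensorProduct.map_tmul, headBlock_one, hV1, LinearMap.flip_apply, hC1,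
        map_add, map_smul, deconc_ι, deconc_ι_mul, hX1, hY', LinearMap.rTensor_tmul, mul_one,
        LinearMap.mulLeft_apply, TensorProduct.tmul_add, TensorProduct.add_tmul,
        TensorProduct.tmul_smul, TensorProduct.smul_tmul', smul_add,
        Algebra.algebraMap_eq_smul_one]
      simp only [← TensorProduct.smul_tmul', hrY]
      abel
    | add v w hv hw =>
      intro u
      simp only [map_add, LinearMap.add_apply, hv, hw, TensorProduct.tmul_add]
      abel
    | smul c w hw =>
      intro u
      simp only [map_smul, LinearMap.smul_apply, hw, TensorProduct.tmul_smul, smul_add]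
    | mul x w hw =>
      intro u
      have hCx : C.flip u ∘ₗ LinearMap.mulLeft k (TensorAlgebra.ι k x) =
          C.flip (u * TensorAlgebra.ι k x) +
          LinearMap.mulLeft k (TensorAlgebra.ι k (a u)) ∘ₗ C.flip (TensorAlgebra.ι k x) +
          LinearMap.mulLeft k (TensorAlgebra.ι k (b u)) ∘ₗ
            (Y ∘ₗ LinearMap.mulLeft k (TensorAlgebra.ι k x)) :=
        LinearMap.ext fun w => hCι x w u
      have hBx : headBlock a V u ∘ₗ LinearMap.mulLeft k (TensorAlgebra.ι k x) =
          LinearMap.mulLeft k (TensorAlgebra.ι k (a u)) ∘ₗ headBlock a V (TensorAlgebra.ι k x) +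
            headBlock a V (u * TensorAlgebra.ι k x) :=
        LinearMap.ext fun w => by simp [headBlock_ι_mul, hV]
      simp only [hCι, map_add, deconc_ι_mul, hw, TensorProduct.map_tmul, map_rTensor_apply, hCx,
        hBx, TensorProduct.map_add_left, LinearMap.add_apply, rTensor_map_apply, hY',
        LinearMap.rTensor_tmul, headBlock_one, hV1, hXx, LinearMap.mulLeft_apply, mul_one,
        LinearMap.flip_apply, TensorProduct.tmul_add, TensorProduct.add_tmul, hC1,
        ← TensorProduct.smul_tmul', hrY]
      abel
  refine LinearMap.ext fun w => ?_
  induction w using bar_induction with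
  | one =>
    simp only [LinearMap.comp_apply, LinearMap.add_apply, deconc_one, TensorProduct.map_tmul, hXY,
      hV1]
    rw [hX1, Algebra.algebraMap_eq_smul_one, map_smul, deconc_one, TensorProduct.tmul_smul,
      add_zero]
  | add v w hv hw => rw [map_add, hv, hw, map_add]
  | smul c w hw => rw [map_smul, hw, map_smul]
  | mul x w _ =>
    simp only [LinearMap.comp_apply, LinearMap.add_apply, deconc_ι_mul, TensorProduct.map_tmul, hXY,
      hV1, map_add, map_rTensor_apply, hVx, hXx', zero_add, hXx, key]

/-- A single letter arises only when the first block is the whole word; the empty remainder then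
contributes `r` through `X` and `s` through `Y`. -/
theorem proj_pendingBlock {s : k} (hs : counit k H' ∘ₗ Y = s • counit k H) (w u : Bar k H) :
    proj k H' (pendingBlock a b Y r w u) = r • a (u * w) + s • b (u * w) := by
  have hs' (w) := LinearMap.congr_fun hs w
  simp only [LinearMap.comp_apply, LinearMap.smul_apply] at hs'
  induction w using bar_induction generalizing u with
  | one => simp [pendingBlock_one, proj_ι, proj_ι_mul, hs', counit_one]
  | add v w hv hw => simp only [map_add, LinearMap.add_apply, hv, hw, mul_add, smul_add]; abel
  | smul c w hw =>
    simp only [map_smul, LinearMap.smul_apply, hw, mul_smul_comm, smul_add]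
    rw [smul_comm c, smul_comm c]
  | mul x w hw =>
    simp [pendingBlock_ι_mul, hw, proj_ι_mul, counit_pendingBlock, hs', counit_ι_mul, mul_assoc]

theorem proj_ofBlocks {s : k} (hs : counit k H' ∘ₗ Y = s • counit k H) (w : Bar k H) :
    proj k H' (ofBlocks a b Y r w) = r • a w + s • b w := by
  simp [ofBlocks, proj_pendingBlock Y r hs, Algebra.algebraMap_eq_smul_one, proj_one]

end BlockRecursion

/-! ### Total degree and Koszul signs on the tensor coalgebra. -/

section Degree

variable {k : Type*} [Field k] {H : Type*} [AddCommGroup H] [Module k H]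
  {H' : Type*} [AddCommGroup H'] [Module k H']
  (ℋ : ℤ → Submodule k H) (ℋ' : ℤ → Submodule k H')

theorem one_mem_barDegree : (1 : Bar k H) ∈ barDegree ℋ 0 :=
  Submodule.subset_span ⟨[], by simp, by simp⟩

variable {ℋ ℋ'}

theorem ι_mul_mem_barDegree {i d : ℤ} {x : H} {w : Bar k H} (hx : x ∈ ℋ i)
    (hw : w ∈ barDegree ℋ d) : TensorAlgebra.ι k x * w ∈ barDegree ℋ (i + d) := by
  induction hw using Submodule.span_induction with
  | mem w hw =>
    obtain ⟨l, rfl, rfl⟩ := hw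
    exact Submodule.subset_span ⟨⟨i, x, hx⟩ :: l, by simp, by simp⟩
  | zero => simp
  | add a b _ _ ha hb => rw [mul_add]; exact add_mem ha hb
  | smul c a _ ha => rw [mul_smul_comm]; exact Submodule.smul_mem _ _ ha

theorem ι_mem_barDegree {i : ℤ} {x : H} (hx : x ∈ ℋ i) :
    TensorAlgebra.ι k x ∈ barDegree ℋ i := by
  simpa using ι_mul_mem_barDegree hx (one_mem_barDegree ℋ)

theorem mul_mem_barDegree {c d : ℤ} {v w : Bar k H} (hv : v ∈ barDegree ℋ c)
    (hw : w ∈ barDegree ℋ d) : v * w ∈ barDegree ℋ (c + d) := by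
  induction hv using Submodule.span_induction with
  | mem v hv =>
    obtain ⟨l, rfl, rfl⟩ := hv
    induction l with
    | nil => simpa using hw
    | cons o l ih =>
      simpa [mul_assoc, add_assoc] using ι_mul_mem_barDegree o.2.2 ih
  | zero => simp
  | add a b _ _ ha hb => rw [add_mul]; exact add_mem ha hb
  | smul c a _ ha => rw [smul_mul_assoc]; exact Submodule.smul_mem _ _ ha

theorem proj_mem {d : ℤ} {w : Bar k H} (hw : w ∈ barDegree ℋ d) : proj k H w ∈ ℋ d := by
  induction hw using Submodule.span_induction with
  | mem w hw =>
    obtain ⟨l, rfl, rfl⟩ := hw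
    match l with
    | [] => simp [proj_one]
    | [o] => simp [proj_ι]
    | o :: p :: l => simp [proj_ι_mul, counit_ι_mul]
  | zero => simp
  | add a b _ _ ha hb => rw [map_add]; exact add_mem ha hb
  | smul c a _ ha => rw [map_smul]; exact Submodule.smul_mem _ _ ha

/-- The condition `hr` makes the constant `r` homogeneous of degree `c`. It is used with `c = 0`, `r
= 1` and with `c = -1`, `r = 0`. -/
theorem pendingBlock_mem {a b : Bar k H →ₗ[k] H'} {Y : Bar k H →ₗ[k] Bar k H'} {r : k} {c : ℤ}
    (ha : ∀ d, ∀ w ∈ barDegree ℋ d, a w ∈ ℋ' d)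
    (hb : ∀ d, ∀ w ∈ barDegree ℋ d, b w ∈ ℋ' (d + c))
    (hY : ∀ d, ∀ w ∈ barDegree ℋ d, Y w ∈ barDegree ℋ' d)
    (hr : algebraMap k (Bar k H') r ∈ barDegree ℋ' c)
    {d e : ℤ} {w u : Bar k H} (hw : w ∈ barDegree ℋ d) (hu : u ∈ barDegree ℋ e) :
    pendingBlock a b Y r w u ∈ barDegree ℋ' (e + d + c) := by
  induction hw using Submodule.span_induction with
  | mem w hw =>
    obtain ⟨l, rfl, rfl⟩ := hw
    induction l generalizing u e with
    | nil =>
      simp only [List.map_nil, List.prod_nil, List.sum_nil, pendingBlock_one]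
      refine add_mem ?_ ?_
      · have := ι_mul_mem_barDegree (ha _ _ hu) hr
        rwa [← Algebra.commutes, ← Algebra.smul_def, ← add_zero e] at this
      · have := ι_mul_mem_barDegree (hb _ _ hu) (hY _ _ (one_mem_barDegree ℋ))
        rwa [add_right_comm] at this
    | cons o l ih =>
      have hl : (l.map fun o => TensorAlgebra.ι k (o.2 : H)).prod ∈
          barDegree ℋ (l.map Sigma.fst).sum := Submodule.subset_span ⟨l, rfl, rfl⟩
      simp only [List.map_cons, List.prod_cons, List.sum_cons, pendingBlock_ι_mul]
      refine add_mem (add_mem ?_ ?_) ?_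
      · have := ih (mul_mem_barDegree hu (ι_mem_barDegree o.2.2))
        rwa [add_assoc e] at this
      · have := ι_mul_mem_barDegree (ha _ _ hu) (ih (ι_mem_barDegree o.2.2))
        rwa [← add_assoc] at this
      · have := ι_mul_mem_barDegree (hb _ _ hu) (hY _ _ (ι_mul_mem_barDegree o.2.2 hl))
        rwa [add_right_comm] at this
  | zero => simp
  | add a b _ _ ha hb => rw [map_add]; exact add_mem ha hb
  | smul c a _ ha => rw [map_smul]; exact Submodule.smul_mem _ _ ha

theorem counit_smul_mem {c d : ℤ} {r : k} (hr : algebraMap k (Bar k H') r ∈ barDegree ℋ' c)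
    {w : Bar k H} (hw : w ∈ barDegree ℋ d) :
    counit k H w • algebraMap k (Bar k H') r ∈ barDegree ℋ' (d + c) := by
  induction hw using Submodule.span_induction with
  | mem w hw =>
    obtain ⟨l, rfl, rfl⟩ := hw
    match l with
    | [] => simpa [counit_one] using hr
    | o :: l => simp [counit_ι_mul]
  | zero => simp
  | add a b _ _ ha hb => rw [map_add, add_smul]; exact add_mem ha hb
  | smul c a _ ha => rw [map_smul, smul_assoc]; exact Submodule.smul_mem _ _ ha

theorem ofBlocks_mem {a b : Bar k H →ₗ[k] H'} {Y : Bar k H →ₗ[k] Bar k H'} {r : k} {c : ℤ}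
    (ha : ∀ d, ∀ w ∈ barDegree ℋ d, a w ∈ ℋ' d)
    (hb : ∀ d, ∀ w ∈ barDegree ℋ d, b w ∈ ℋ' (d + c))
    (hY : ∀ d, ∀ w ∈ barDegree ℋ d, Y w ∈ barDegree ℋ' d)
    (hr : algebraMap k (Bar k H') r ∈ barDegree ℋ' c)
    {d : ℤ} {w : Bar k H} (hw : w ∈ barDegree ℋ d) :
    ofBlocks a b Y r w ∈ barDegree ℋ' (d + c) := by
  have h := pendingBlock_mem ha hb hY hr hw (one_mem_barDegree ℋ)
  rw [zero_add] at h
  refine add_mem ?_ h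
  have h2 := counit_smul_mem hr hw
  simpa [Algebra.algebraMap_eq_smul_one, smul_smul, mul_comm] using h2

variable (ℋ) [DirectSum.Decomposition ℋ]

/-- Only the fact that the degree parts span is needed, not that their sum is direct. -/
theorem bar_homogeneous_induction {P : Bar k H → Prop}
    (hom : ∀ d, ∀ w ∈ barDegree ℋ d, P w)
    (add : ∀ a b, P a → P b → P (a + b)) (w : Bar k H) : P w := by
  suffices h : w ∈ ⨆ d, barDegree ℋ d by
    induction h using Submodule.iSup_induction' with
    | mem d w hw => exact hom d w hw
    | zero => exact hom 0 0 (zero_mem _)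
    | add a b _ _ ha hb => exact add a b ha hb
  induction w using bar_induction with
  | one => exact Submodule.mem_iSup_of_mem 0 (one_mem_barDegree ℋ)
  | add a b ha hb => exact add_mem ha hb
  | smul c a ha => exact Submodule.smul_mem _ _ ha
  | mul x w hw =>
    induction x using DirectSum.Decomposition.inductionOn ℋ with
    | zero => simp
    | add x y hx hy => rw [map_add, add_mul]; exact add_mem hx hy
    | homogeneous x =>
      rename_i i
      induction hw using Submodule.iSup_induction' with
      | mem d w hw => exact Submodule.mem_iSup_of_mem _ (ι_mul_mem_barDegree x.2 hw)
      | zero => simp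
      | add a b _ _ ha hb => rw [mul_add]; exact add_mem ha hb

theorem bar_hom_ext {M : Type*} [AddCommGroup M] [Module k M] {φ ψ : Bar k H →ₗ[k] M}
    (h : ∀ d, ∀ w ∈ barDegree ℋ d, φ w = ψ w) : φ = ψ :=
  LinearMap.ext fun w => bar_homogeneous_induction ℋ h
    (fun a b ha hb => by rw [map_add, map_add, ha, hb]) w

theorem barSign_one : barSign ℋ (1 : Bar k H) = 1 := by simp [barSign]

theorem negOnePow_mul_self (d : ℤ) : ((d.negOnePow : ℤ) : k) * ((d.negOnePow : ℤ) : k) = 1 := by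
  rw [← Int.cast_mul, ← Units.val_mul, Int.units_mul_self]; simp

theorem barSign_barSign (w : Bar k H) : barSign ℋ (barSign ℋ w) = w := by
  suffices h : barSign ℋ ∘ₗ barSign ℋ = LinearMap.id from LinearMap.congr_fun h w
  refine bar_hom_ext ℋ fun d w hw => ?_
  rw [LinearMap.comp_apply, barSign_apply ℋ hw, map_smul, barSign_apply ℋ hw, smul_smul,
    negOnePow_mul_self, one_smul, LinearMap.id_apply]

theorem barSign_ι_mul (x : H) (w : Bar k H) : barSign ℋ (TensorAlgebra.ι k x * w) =
    TensorAlgebra.ι k (letterSign ℋ x) * barSign ℋ w := by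
  simp [barSign]

theorem counit_barSign : counit k H ∘ₗ barSign ℋ = counit k H := by
  refine LinearMap.ext fun w => ?_
  induction w using bar_induction with
  | one => simp [barSign_one]
  | add a b ha hb => rw [map_add, ha, hb, map_add]
  | smul c a ha => rw [map_smul, ha, map_smul]
  | mul x w _ => rw [LinearMap.comp_apply, barSign_ι_mul, counit_ι_mul, counit_ι_mul]

theorem deconc_barSign : deconc k H ∘ₗ barSign ℋ =
    TensorProduct.map (barSign ℋ) (barSign ℋ) ∘ₗ deconc k H := by
  refine LinearMap.ext fun w => ?_
  induction w using bar_induction with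
  | one => simp [barSign_one, deconc_one]
  | add a b ha hb => rw [map_add, ha, hb, map_add]
  | smul c a ha => rw [map_smul, ha, map_smul]
  | mul x w hw =>
    simp only [LinearMap.comp_apply] at hw ⊢
    rw [barSign_ι_mul, deconc_ι_mul, hw, deconc_ι_mul, map_add, TensorProduct.map_tmul,
      barSign_one, barSign_ι_mul, map_rTensor_apply, rTensor_map_apply]
    congr 3
    exact LinearMap.ext fun v => (barSign_ι_mul ℋ x v).symm

variable {ℋ} [DirectSum.Decomposition ℋ']

/-- This is the Koszul rule: `TensorProduct.map` carries no signs, so they enter by moving `barSign`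
past homogeneous maps. -/
theorem barSign_comp_of_degree {φ : Bar k H →ₗ[k] Bar k H'} {c : ℤ}
    (hφ : ∀ d, ∀ w ∈ barDegree ℋ d, φ w ∈ barDegree ℋ' (d + c)) :
    barSign ℋ' ∘ₗ φ = ((c.negOnePow : ℤ) : k) • (φ ∘ₗ barSign ℋ) := by
  refine bar_hom_ext ℋ fun d w hw => ?_
  rw [LinearMap.comp_apply, barSign_apply _ (hφ d w hw), LinearMap.smul_apply,
    LinearMap.comp_apply, barSign_apply _ hw, map_smul, smul_smul, Int.negOnePow_add, mul_comm]
  simp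

end Degree

/-! ### The filtration by word length. -/

section Length

variable {k : Type*} [Field k] {H : Type*} [AddCommGroup H] [Module k H]
  {H' : Type*} [AddCommGroup H'] [Module k H']

variable (k H) in
/-- The span of the words of length less than `n`. -/
def lengthLT (n : ℕ) : Submodule k (Bar k H) :=
  Submodule.span k {w | ∃ l : List H, l.length < n ∧ w = (l.map (TensorAlgebra.ι k)).prod}

theorem word_mem_lengthLT {l : List H} {n : ℕ} (h : l.length < n) :
    (l.map (TensorAlgebra.ι k)).prod ∈ lengthLT k H n :=
  Submodule.subset_span ⟨l, h, rfl⟩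

theorem one_mem_lengthLT (n : ℕ) : (1 : Bar k H) ∈ lengthLT k H (n + 1) :=
  word_mem_lengthLT (l := []) (by simp)

theorem ι_mem_lengthLT (n : ℕ) (x : H) : TensorAlgebra.ι k x ∈ lengthLT k H (n + 2) := by
  simpa using word_mem_lengthLT (k := k) (l := [x]) (n := n + 2) (by simp)

theorem lengthLT_mono {m n : ℕ} (h : m ≤ n) : lengthLT k H m ≤ lengthLT k H n :=
  Submodule.span_mono fun _ ⟨l, hl, hw⟩ => ⟨l, hl.trans_le h, hw⟩

theorem lengthLT_zero : lengthLT k H 0 = ⊥ := by simp [lengthLT]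

theorem ι_mul_mem_lengthLT {n : ℕ} (x : H) {w : Bar k H} (hw : w ∈ lengthLT k H n) :
    TensorAlgebra.ι k x * w ∈ lengthLT k H (n + 1) := by
  induction hw using Submodule.span_induction with
  | mem w hw =>
    obtain ⟨l, hl, rfl⟩ := hw
    simpa using word_mem_lengthLT (k := k) (l := x :: l) (n := n + 1) (by simpa using hl)
  | zero => simp
  | add a b _ _ ha hb => rw [mul_add]; exact add_mem ha hb
  | smul c a _ ha => rw [mul_smul_comm]; exact Submodule.smul_mem _ _ ha

theorem exists_mem_lengthLT (w : Bar k H) : ∃ n, w ∈ lengthLT k H n := by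
  induction w using bar_induction with
  | one => exact ⟨1, one_mem_lengthLT 0⟩
  | add a b ha hb =>
    obtain ⟨m, hm⟩ := ha
    obtain ⟨n, hn⟩ := hb
    exact ⟨max m n, add_mem (lengthLT_mono (le_max_left _ _) hm)
      (lengthLT_mono (le_max_right _ _) hn)⟩
  | smul c a ha => exact ha.imp fun n hn => Submodule.smul_mem _ _ hn
  | mul x w hw => exact hw.elim fun n hn => ⟨n + 1, ι_mul_mem_lengthLT x hn⟩

variable {M N : Type*} [AddCommGroup M] [Module k M] [AddCommGroup N] [Module k N]

/-- A map vanishing on words of length `< n` sees only the term `w ⊗ 1` of `Δ w` when `w` has length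
at most `n`. -/
theorem map_deconc_of_vanish_left {X : Bar k H →ₗ[k] M} {U : Bar k H →ₗ[k] N} {n : ℕ}
    (hX : ∀ w ∈ lengthLT k H n, X w = 0) {w : Bar k H} (hw : w ∈ lengthLT k H (n + 1)) :
    TensorProduct.map X U (deconc k H w) = X w ⊗ₜ U 1 := by
  induction hw using Submodule.span_induction with
  | mem w hw =>
    obtain ⟨l, hl, rfl⟩ := hw
    rw [deconc_word, map_sum, Finset.sum_eq_single l.length]
    · simp
    · intro j hj hne
      have : (l.take j).length < n := by
        rw [List.length_take]; have := Finset.mem_range.mp hj; omega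
      rw [TensorProduct.map_tmul, hX _ (word_mem_lengthLT this), TensorProduct.zero_tmul]
    · simp
  | zero => simp
  | add a b _ _ ha hb => simp only [map_add, ha, hb, TensorProduct.add_tmul]
  | smul c a _ ha => simp only [map_smul, ha, TensorProduct.smul_tmul']

theorem map_deconc_of_vanish_right {X : Bar k H →ₗ[k] M} {U : Bar k H →ₗ[k] N} {n : ℕ}
    (hX : ∀ w ∈ lengthLT k H n, X w = 0) {w : Bar k H} (hw : w ∈ lengthLT k H (n + 1)) :
    TensorProduct.map U X (deconc k H w) = U 1 ⊗ₜ X w := by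
  induction hw using Submodule.span_induction with
  | mem w hw =>
    obtain ⟨l, hl, rfl⟩ := hw
    rw [deconc_word, map_sum, Finset.sum_eq_single 0]
    · simp
    · intro j hj hne
      have : (l.drop j).length < n := by
        rw [List.length_drop]; have := Finset.mem_range.mp hj; omega
      rw [TensorProduct.map_tmul, hX _ (word_mem_lengthLT this), TensorProduct.tmul_zero]
    · simp
  | zero => simp
  | add a b _ _ ha hb => simp only [map_add, ha, hb, TensorProduct.tmul_add]
  | smul c a _ ha => simp only [map_smul, ha, TensorProduct.tmul_smul]

theorem barSign_mem_lengthLT (ℋ : ℤ → Submodule k H) [DirectSum.Decomposition ℋ] {n : ℕ}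
    {w : Bar k H} (hw : w ∈ lengthLT k H n) : barSign ℋ w ∈ lengthLT k H n := by
  induction hw using Submodule.span_induction with
  | mem w hw =>
    obtain ⟨l, hl, rfl⟩ := hw
    have : barSign ℋ (l.map (TensorAlgebra.ι k)).prod =
        ((l.map (letterSign ℋ)).map (TensorAlgebra.ι k)).prod := by
      simp [barSign, map_list_prod, Function.comp_def]
    rw [this]
    exact word_mem_lengthLT (by simpa using hl)
  | zero => simp
  | add a b _ _ ha hb => rw [map_add]; exact add_mem ha hb
  | smul c a _ ha => rw [map_smul]; exact Submodule.smul_mem _ _ ha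

/-- Since `m₀ = 0`, the codifferential never lengthens words. Hence an identity involving `m` can be
tested inside one filtration step. -/
theorem AInftyAlgebra.m_mem_lengthLT {ℋ : ℤ → Submodule k H} [DirectSum.Decomposition ℋ]
    (A : AInftyAlgebra ℋ) {n : ℕ} {w : Bar k H} (hw : w ∈ lengthLT k H n) :
    A.m w ∈ lengthLT k H n := by
  induction hw using Submodule.span_induction with
  | mem w hw =>
    obtain ⟨l, hl, rfl⟩ := hw
    induction hn : l.length using Nat.strong_induction_on generalizing l n with
    | _ p ih =>
      subst hn
      rcases l with - | ⟨x, l⟩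
      · simp [A.m_one]
      obtain ⟨n, rfl⟩ : ∃ q, n = q + 2 := ⟨n - 2, by simp at hl; omega⟩
      have h := firstLetter_deconc (A.m ((x :: l).map (TensorAlgebra.ι k)).prod)
      rw [eq_comm, sub_eq_iff_eq_add] at h
      rw [h]
      refine add_mem ?_ ?_
      · have h2 := LinearMap.congr_fun A.coderivation ((x :: l).map (TensorAlgebra.ι k)).prod
        rw [LinearMap.comp_apply] at h2
        rw [h2, LinearMap.add_apply, LinearMap.comp_apply, LinearMap.comp_apply, deconc_word,
          map_sum, map_sum, ← Finset.sum_add_distrib, map_sum]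
        refine sum_mem fun j hj => ?_
        rw [TensorProduct.map_tmul, TensorProduct.map_tmul, map_add, firstLetter_tmul,
          firstLetter_tmul]
        -- The split with empty left part drops out because `m 1 = 0` and the empty word has no
        -- letter component. Every other right part is strictly shorter, so the induction hypothesis
        -- applies to it.
        rcases Nat.eq_zero_or_pos j with rfl | hj0
        · simp [A.m_one, barSign_one, proj_one]
        have hlen : ((x :: l).drop j).length < n + 1 := by
          rw [List.length_drop]; omega
        refine add_mem (ι_mul_mem_lengthLT _ (word_mem_lengthLT hlen))
          (ι_mul_mem_lengthLT _ (ih _ ?_ _ hlen rfl))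
        rw [List.length_drop]; simp; omega
      · rw [Algebra.algebraMap_eq_smul_one]
        exact Submodule.smul_mem _ _ (one_mem_lengthLT _)
  | zero => simp
  | add a b _ _ ha hb => rw [map_add]; exact add_mem ha hb
  | smul c a _ ha => rw [map_smul]; exact Submodule.smul_mem _ _ ha

/-- A sequence of linear maps that stabilizes on words of bounded length has a limit. -/
theorem exists_limit_of_stable (g : ℕ → Bar k H →ₗ[k] M)
    (hg : ∀ n, ∀ w ∈ lengthLT k H n, g (n + 1) w = g n w) :
    ∃ g' : Bar k H →ₗ[k] M, ∀ n, ∀ w ∈ lengthLT k H n, g' w = g n w := by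
  have h1 : ∀ n p, ∀ w ∈ lengthLT k H n, g (n + p) w = g n w := by
    intro n p w hw
    induction p with
    | zero => rfl
    | succ p ih => rw [← add_assoc, hg _ _ (lengthLT_mono (Nat.le_add_right n p) hw), ih]
  have h2 : ∀ m n, ∀ w ∈ lengthLT k H m, w ∈ lengthLT k H n → g m w = g n w := by
    intro m n w hm hn
    rw [← h1 m n w hm, ← h1 n m w hn, add_comm]
  -- The limit at `w` is evaluated at any length bound for `w`; linearity is checked at a common
  -- bound.
  choose N hN using exists_mem_lengthLT (k := k) (H := H)
  refine ⟨⟨⟨fun w => g (N w) w, fun v w => ?_⟩, fun c w => ?_⟩, fun n w hw => h2 _ _ w (hN w) hw⟩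
  · have hv := lengthLT_mono (le_max_left (N v) (N w)) (hN v)
    have hw := lengthLT_mono (le_max_right (N v) (N w)) (hN w)
    rw [h2 _ _ _ (hN v) hv, h2 _ _ _ (hN w) hw, h2 _ _ _ (hN (v + w)) (add_mem hv hw), map_add]
  · change g (N (c • w)) (c • w) = c • g (N w) w
    rw [h2 _ _ _ (hN (c • w)) (Submodule.smul_mem _ c (hN w)), map_smul]

end Length

/-! ### Homogeneous contraction of an acyclic mapping cone. -/

section Contraction

variable {k : Type*} [Field k] {V : Type*} [AddCommGroup V] [Module k V]
  {W : Type*} [AddCommGroup W] [Module k W]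

/-- An exact differential on a vector space is contractible. -/
theorem exists_contraction (d : V →ₗ[k] V) (hd : ∀ v, d (d v) = 0)
    (hex : ∀ v, d v = 0 → ∃ u, d u = v) :
    ∃ s : V →ₗ[k] V, ∀ v, d (s v) + s (d v) = v := by
  obtain ⟨σ, hσ⟩ := d.rangeRestrict.exists_rightInverse_of_surjective d.range_rangeRestrict
  obtain ⟨r, hr⟩ := σ.exists_extend
  have h : ∀ v, d (r (d v)) = d v := fun v => by
    have h1 : r (d v) = σ ⟨d v, v, rfl⟩ := (LinearMap.congr_fun hr ⟨d v, v, rfl⟩)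
    have h2 := LinearMap.congr_fun hσ ⟨d v, v, rfl⟩
    rw [h1]
    exact congrArg Subtype.val h2
  -- This is `r ∘ (1 - r d)`. Because `d r d = d`, the map `1 - r d` takes values in cycles, which
  -- are boundaries by exactness, and `d r` is the identity on boundaries.
  refine ⟨r - r ∘ₗ r ∘ₗ d, fun v => ?_⟩
  obtain ⟨u, hu⟩ := hex (v - r (d v)) (by rw [map_sub, h, sub_self])
  have h3 := h u
  rw [hu, map_sub, map_sub] at h3
  simp only [LinearMap.sub_apply, LinearMap.comp_apply, hd, map_zero, sub_zero, map_sub]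
  rw [h3]
  abel

variable (𝒱 : ℤ → Submodule k V) [DirectSum.Decomposition 𝒱]
  (𝒲 : ℤ → Submodule k W) [DirectSum.Decomposition 𝒲]

/-- The projection of a graded vector space to its degree `i` part. -/
def degreeProj (i : ℤ) : V →ₗ[k] V :=
  (𝒱 i).subtype ∘ₗ DirectSum.component k ℤ (fun i => 𝒱 i) i ∘ₗ
    (DirectSum.decomposeLinearEquiv 𝒱).toLinearMap

theorem degreeProj_apply (i : ℤ) (v : V) : degreeProj 𝒱 i v = DirectSum.decompose 𝒱 v i := rfl

theorem degreeProj_mem (i : ℤ) (v : V) : degreeProj 𝒱 i v ∈ 𝒱 i := SetLike.coe_mem _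

theorem degreeProj_of_mem {i : ℤ} {v : V} (hv : v ∈ 𝒱 i) : degreeProj 𝒱 i v = v :=
  DirectSum.decompose_of_mem_same 𝒱 hv

/-- The degree `c` part of a linear map of graded vector spaces. -/
def degreePart (c : ℤ) (φ : V →ₗ[k] W) : V →ₗ[k] W :=
  DirectSum.toModule k ℤ W (fun i => degreeProj 𝒲 (i + c) ∘ₗ φ ∘ₗ (𝒱 i).subtype) ∘ₗ
    (DirectSum.decomposeLinearEquiv 𝒱).toLinearMap

variable {𝒱}

theorem degreePart_apply (c : ℤ) (φ : V →ₗ[k] W) {i : ℤ} {v : V} (hv : v ∈ 𝒱 i) :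
    degreePart 𝒱 𝒲 c φ v = degreeProj 𝒲 (i + c) (φ v) := by
  simp [degreePart, DirectSum.decomposeLinearEquiv_apply, DirectSum.decompose_of_mem 𝒱 hv,
    ← DirectSum.lof_eq_of k]

theorem degreePart_mem (c : ℤ) (φ : V →ₗ[k] W) {i : ℤ} {v : V} (hv : v ∈ 𝒱 i) :
    degreePart 𝒱 𝒲 c φ v ∈ 𝒲 (i + c) := by
  rw [degreePart_apply 𝒲 c φ hv]
  exact degreeProj_mem _ _ _

variable {𝒲}

/-- Homogeneous maps commute with the projections to homogeneous parts. -/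
theorem degreeProj_map {φ : V →ₗ[k] W} {c : ℤ} (hφ : ∀ i, ∀ v ∈ 𝒱 i, φ v ∈ 𝒲 (i + c))
    (i : ℤ) (v : V) : φ (degreeProj 𝒱 i v) = degreeProj 𝒲 (i + c) (φ v) := by
  induction v using DirectSum.Decomposition.inductionOn 𝒱 with
  | zero => simp
  | add x y hx hy => simp only [map_add, hx, hy]
  | homogeneous x =>
    rename_i j
    rcases eq_or_ne j i with rfl | h
    · rw [degreeProj_of_mem 𝒱 x.2, degreeProj_of_mem 𝒲 (hφ _ _ x.2)]
    · rw [degreeProj_apply, degreeProj_apply, DirectSum.decompose_of_mem_ne 𝒱 x.2 h,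
        DirectSum.decompose_of_mem_ne 𝒲 (hφ _ _ x.2) (by simpa using h), map_zero]

/-- Linear maps of graded vector spaces agree if they agree on homogeneous elements. -/
theorem graded_hom_ext {φ ψ : V →ₗ[k] W} (h : ∀ i, ∀ v ∈ 𝒱 i, φ v = ψ v) (v : V) :
    φ v = ψ v := by
  induction v using DirectSum.Decomposition.inductionOn 𝒱 with
  | zero => simp
  | add x y hx hy => simp only [map_add, hx, hy]
  | homogeneous x => exact h _ _ x.2

/-- Taking a homogeneous part commutes with composition by a homogeneous map, so the contraction
identities survive when the contraction is replaced by its homogeneous part. -/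
theorem degreePart_comp_left {U : Type*} [AddCommGroup U] [Module k U] {𝒰 : ℤ → Submodule k U}
    [DirectSum.Decomposition 𝒰] {φ : V →ₗ[k] W} {c : ℤ}
    (hφ : ∀ i, ∀ v ∈ 𝒱 i, φ v ∈ 𝒲 (i + c)) (b : ℤ) (ψ : U →ₗ[k] V) (u : U) :
    φ (degreePart 𝒰 𝒱 b ψ u) = degreePart 𝒰 𝒲 (b + c) (φ ∘ₗ ψ) u := by
  refine graded_hom_ext (𝒱 := 𝒰) (φ := φ ∘ₗ degreePart 𝒰 𝒱 b ψ) (fun i v hv => ?_) u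
  rw [LinearMap.comp_apply, degreePart_apply _ _ _ hv, degreePart_apply _ _ _ hv,
    degreeProj_map hφ, add_assoc, LinearMap.comp_apply]

theorem degreePart_comp_right {U : Type*} [AddCommGroup U] [Module k U] {𝒰 : ℤ → Submodule k U}
    [DirectSum.Decomposition 𝒰] {φ : U →ₗ[k] V} {c : ℤ}
    (hφ : ∀ i, ∀ u ∈ 𝒰 i, φ u ∈ 𝒱 (i + c)) (b : ℤ) (ψ : V →ₗ[k] W) (u : U) :
    degreePart 𝒱 𝒲 b ψ (φ u) = degreePart 𝒰 𝒲 (b + c) (ψ ∘ₗ φ) u := by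
  refine graded_hom_ext (𝒱 := 𝒰) (φ := degreePart 𝒱 𝒲 b ψ ∘ₗ φ) (fun i v hv => ?_) u
  rw [LinearMap.comp_apply, degreePart_apply _ _ _ (hφ _ _ hv), degreePart_apply _ _ _ hv,
    add_assoc, add_comm c, LinearMap.comp_apply]

theorem degreePart_add (c : ℤ) (φ ψ : V →ₗ[k] W) (v : V) :
    degreePart 𝒱 𝒲 c (φ + ψ) v = degreePart 𝒱 𝒲 c φ v + degreePart 𝒱 𝒲 c ψ v :=
  graded_hom_ext (𝒱 := 𝒱) (ψ := degreePart 𝒱 𝒲 c φ + degreePart 𝒱 𝒲 c ψ) (fun i v hv => by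
    rw [LinearMap.add_apply, degreePart_apply _ _ _ hv, degreePart_apply _ _ _ hv,
      degreePart_apply _ _ _ hv, LinearMap.add_apply, map_add]) v

theorem degreePart_neg (c : ℤ) (φ : V →ₗ[k] W) (v : V) :
    degreePart 𝒱 𝒲 c (-φ) v = -degreePart 𝒱 𝒲 c φ v :=
  graded_hom_ext (𝒱 := 𝒱) (ψ := -degreePart 𝒱 𝒲 c φ) (fun i v hv => by
    rw [LinearMap.neg_apply, degreePart_apply _ _ _ hv, degreePart_apply _ _ _ hv,
      LinearMap.neg_apply, map_neg]) v

theorem degreePart_zero (c : ℤ) (v : V) :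
    degreePart 𝒱 𝒲 c 0 v = 0 :=
  graded_hom_ext (𝒱 := 𝒱) (ψ := (0 : V →ₗ[k] W)) (fun i v hv => by
    rw [degreePart_apply _ _ _ hv, LinearMap.zero_apply, map_zero]) v

theorem degreePart_id (v : V) : degreePart 𝒱 𝒱 0 LinearMap.id v = v :=
  graded_hom_ext (𝒱 := 𝒱) (ψ := LinearMap.id) (fun i v hv => by
    rw [degreePart_apply _ _ _ hv, LinearMap.id_apply, add_zero, degreeProj_of_mem _ hv]) v

/-- The mapping cone of a quasi-isomorphism `f` of complexes of graded vector spaces has a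
contraction that respects the gradings, given here by its four blocks. -/
theorem exists_cone_contraction {d : V →ₗ[k] V} {d' : W →ₗ[k] W} {f : V →ₗ[k] W}
    (hd : ∀ i, ∀ v ∈ 𝒱 i, d v ∈ 𝒱 (i + 1)) (hd' : ∀ i, ∀ v ∈ 𝒲 i, d' v ∈ 𝒲 (i + 1))
    (hf : ∀ i, ∀ v ∈ 𝒱 i, f v ∈ 𝒲 i)
    (hdd : ∀ v, d (d v) = 0) (hdd' : ∀ v, d' (d' v) = 0) (hfd : ∀ v, f (d v) = d' (f v))
    (hinj : ∀ v w, d v = 0 → f v = d' w → ∃ u, d u = v)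
    (hsurj : ∀ w, d' w = 0 → ∃ v w', d v = 0 ∧ w = f v + d' w') :
    ∃ (s₁₁ : V →ₗ[k] V) (s₁₂ : W →ₗ[k] V) (s₂₁ : V →ₗ[k] W) (s₂₂ : W →ₗ[k] W),
      (∀ i, ∀ v ∈ 𝒱 i, s₁₁ v ∈ 𝒱 (i - 1)) ∧ (∀ i, ∀ v ∈ 𝒲 i, s₁₂ v ∈ 𝒱 i) ∧
      (∀ i, ∀ v ∈ 𝒱 i, s₂₁ v ∈ 𝒲 (i - 2)) ∧ (∀ i, ∀ v ∈ 𝒲 i, s₂₂ v ∈ 𝒲 (i - 1)) ∧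
      (∀ v, d (s₁₁ v) + s₁₁ (d v) + s₁₂ (f v) = v) ∧
      (∀ v, f (s₁₁ v) - d' (s₂₁ v) + s₂₁ (d v) + s₂₂ (f v) = 0) ∧
      (∀ w, d (s₁₂ w) - s₁₂ (d' w) = 0) ∧
      (∀ w, f (s₁₂ w) - d' (s₂₂ w) - s₂₂ (d' w) = w) := by
  obtain ⟨s, hs⟩ := exists_contraction
    (LinearMap.prod (d ∘ₗ LinearMap.fst k V W)
      (f ∘ₗ LinearMap.fst k V W - d' ∘ₗ LinearMap.snd k V W))
    (fun v => by simp [hdd, hdd', hfd])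
    (fun ⟨v, w⟩ h => by
      simp only [LinearMap.prod_apply, Function.prod_apply, LinearMap.comp_apply,
        LinearMap.sub_apply, LinearMap.fst_apply, LinearMap.snd_apply, Prod.mk_eq_zero,
        sub_eq_zero] at h
      obtain ⟨u, rfl⟩ := hinj v w h.1 h.2
      -- The element `(u, 0)` already hits the first coordinate. The error `f u - w` in the second
      -- is a cocycle, hence `f z + d' w'` with `z` a cocycle, and `(u - z, w')` is a preimage.
      obtain ⟨z, w', hz, hw'⟩ := hsurj (f u - w) (by rw [map_sub, ← h.2, hfd, sub_self])
      refine ⟨(u - z, w'), ?_⟩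
      simp [hz, sub_sub, ← hw'])
  have h1 (v : V) := congrArg Prod.fst (hs (v, 0))
  have h2 (v : V) := congrArg Prod.snd (hs (v, 0))
  have h3 (w : W) := congrArg Prod.fst (hs (0, w))
  have h4 (w : W) := congrArg Prod.snd (hs (0, w))
  set a := LinearMap.fst k V W ∘ₗ s ∘ₗ LinearMap.inl k V W with ha
  set b := LinearMap.fst k V W ∘ₗ s ∘ₗ LinearMap.inr k V W with hb
  set c := LinearMap.snd k V W ∘ₗ s ∘ₗ LinearMap.inl k V W with hc
  set e := LinearMap.snd k V W ∘ₗ s ∘ₗ LinearMap.inr k V W with he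
  have hsplit (v : V) (w : W) : s (v, w) = (a v + b w, c v + e w) := by
    have : (v, w) = ((v, 0) : V × W) + (0, w) := by simp
    rw [this, map_add]
    rfl
  simp only [LinearMap.prod_apply, Function.prod_apply, LinearMap.comp_apply,
    LinearMap.sub_apply, LinearMap.fst_apply, LinearMap.snd_apply, map_zero, hsplit, add_zero,
    sub_zero, zero_add, zero_sub, Prod.fst_add, Prod.snd_add, map_neg] at h1 h2 h3 h4
  clear_value a b c e
  have e1 : d ∘ₗ a + a ∘ₗ d + b ∘ₗ f = LinearMap.id := LinearMap.ext fun v => by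
    simpa [add_assoc] using h1 v
  have e2 : f ∘ₗ a + -(d' ∘ₗ c) + c ∘ₗ d + e ∘ₗ f = 0 := LinearMap.ext fun v => by
    simpa [add_assoc, sub_eq_add_neg] using h2 v
  have e3 : d ∘ₗ b + -(b ∘ₗ d') = 0 := LinearMap.ext fun v => by
    simpa [add_assoc] using h3 v
  have e4 : f ∘ₗ b + -(d' ∘ₗ e) + -(e ∘ₗ d') = LinearMap.id := LinearMap.ext fun v => by
    simpa [add_assoc, sub_eq_add_neg] using h4 v
  have hf0 : ∀ i, ∀ v ∈ 𝒱 i, f v ∈ 𝒲 (i + 0) := fun i v hv => by rw [add_zero]; exact hf i v hv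
  -- The cone in degree `i` is `𝒱 i ⊕ 𝒲 (i - 1)`, so a contraction of degree `-1` has blocks of
  -- degrees `-1`, `0`, `-2`, `-1`.
  refine ⟨degreePart 𝒱 𝒱 (-1) a, degreePart 𝒲 𝒱 0 b, degreePart 𝒱 𝒲 (-2) c,
    degreePart 𝒲 𝒲 (-1) e, fun i v hv => degreePart_mem 𝒱 (-1) a hv,
    fun i v hv => ?_, fun i v hv => degreePart_mem 𝒲 (-2) c hv,
    fun i v hv => degreePart_mem 𝒲 (-1) e hv, fun v => ?_, fun v => ?_, fun w => ?_, fun w => ?_⟩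
  · simpa using degreePart_mem 𝒱 0 b hv
  · rw [degreePart_comp_left hd, degreePart_comp_right hd, degreePart_comp_right hf0]
    norm_num
    rw [← degreePart_add, ← degreePart_add, e1, degreePart_id]
  · rw [sub_eq_add_neg, degreePart_comp_left hd', degreePart_comp_right hd,
      degreePart_comp_right hf0, degreePart_comp_left hf0]
    norm_num
    rw [← degreePart_neg, ← degreePart_add, ← degreePart_add, ← degreePart_add, e2,
      degreePart_zero]
  · rw [sub_eq_add_neg, degreePart_comp_left hd, degreePart_comp_right hd']
    rw [← degreePart_neg, ← degreePart_add, e3, degreePart_zero]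
  · rw [sub_eq_add_neg, sub_eq_add_neg, degreePart_comp_left hf0, degreePart_comp_left hd',
      degreePart_comp_right hd']
    norm_num
    rw [← degreePart_neg, ← degreePart_neg, ← degreePart_add, ← degreePart_add, e4, degreePart_id]

end Contraction

/-! ### Existence and uniqueness of coalgebra maps and coderivations. -/

section CoalgebraMaps

variable {k : Type*} [Field k] {H : Type*} [AddCommGroup H] [Module k H]
  {H' : Type*} [AddCommGroup H'] [Module k H']

theorem tensorMap_sub_left {M N P Q : Type*} [AddCommGroup M] [Module k M] [AddCommGroup N]
    [Module k N] [AddCommGroup P] [Module k P] [AddCommGroup Q] [Module k Q]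
    (f f' : M →ₗ[k] N) (g : P →ₗ[k] Q) :
    TensorProduct.map (f - f') g = TensorProduct.map f g - TensorProduct.map f' g := by
  rw [eq_sub_iff_add_eq, ← TensorProduct.map_add_left, sub_add_cancel]

theorem tensorMap_sub_right {M N P Q : Type*} [AddCommGroup M] [Module k M] [AddCommGroup N]
    [Module k N] [AddCommGroup P] [Module k P] [AddCommGroup Q] [Module k Q]
    (f : M →ₗ[k] N) (g g' : P →ₗ[k] Q) :
    TensorProduct.map f (g - g') = TensorProduct.map f g - TensorProduct.map f g' := by
  rw [eq_sub_iff_add_eq, ← TensorProduct.map_add_right, sub_add_cancel]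

/-- A degree zero homomorphism of counital tensor coalgebras that preserves the empty word. -/
structure IsCoalgebraMap (ℋ : ℤ → Submodule k H) (ℋ' : ℤ → Submodule k H')
    (G : Bar k H →ₗ[k] Bar k H') : Prop where
  map_one : G 1 = 1
  degree : ∀ d : ℤ, ∀ w ∈ barDegree ℋ d, G w ∈ barDegree ℋ' d
  comul : deconc k H' ∘ₗ G = TensorProduct.map G G ∘ₗ deconc k H
  counit : counit k H' ∘ₗ G = counit k H

/-- A `(K, 1)`-coderivation of degree `-1` that kills the empty word. -/
structure IsCoderivation (ℋ : ℤ → Submodule k H) [DirectSum.Decomposition ℋ]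
    (K T : Bar k H →ₗ[k] Bar k H) : Prop where
  map_one : T 1 = 0
  degree : ∀ d : ℤ, ∀ w ∈ barDegree ℋ d, T w ∈ barDegree ℋ (d + -1)
  comul : deconc k H ∘ₗ T =
    TensorProduct.map (K ∘ₗ barSign ℋ) T ∘ₗ deconc k H +
      TensorProduct.map T LinearMap.id ∘ₗ deconc k H

variable {ℋ : ℤ → Submodule k H} {ℋ' : ℤ → Submodule k H'}

/-- Coalgebra maps are freely determined by their letter components. -/
theorem exists_isCoalgebraMap {g : Bar k H →ₗ[k] H'} (h1 : g 1 = 0)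
    (hg : ∀ d, ∀ w ∈ barDegree ℋ d, g w ∈ ℋ' d) :
    ∃ G : Bar k H →ₗ[k] Bar k H', IsCoalgebraMap ℋ ℋ' G ∧ ∀ w, proj k H' (G w) = g w := by
  have h0 : (0 : Bar k H →ₗ[k] H') 1 = 0 := rfl
  have hone : ofBlocks g 0 0 1 1 = (1 : Bar k H') := by
    rw [ofBlocks_one _ _ h1 h0, map_one]
  -- With `b = 0` and `Y = 0` the constructed map satisfies its own block recursion, so
  -- `deconc_ofBlocks` applies with `V = X`.
  have hV : ∀ w u, pendingBlock g 0 0 1 w u = headBlock g (ofBlocks g 0 0 1) u w := by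
    intro w
    induction w using bar_induction with
    | one => intro u; rw [pendingBlock_one, headBlock_one, hone]; simp
    | add v w hv hw => intro u; rw [map_add, map_add, LinearMap.add_apply, hv, hw]
    | smul c w hw => intro u; rw [map_smul, map_smul, LinearMap.smul_apply, hw]
    | mul x w hw =>
      intro u
      rw [pendingBlock_ι_mul, headBlock_ι_mul, ofBlocks_ι_mul _ _ h1 h0, hw]
      simp [add_comm]
  refine ⟨ofBlocks g 0 0 1, ⟨hone, fun d w hw => ?_, ?_, ?_⟩, fun w => ?_⟩
  · have := ofBlocks_mem (Y := 0) (r := (1 : k)) (b := 0) (c := 0) hg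
      (fun d w _ => zero_mem _) (fun d w _ => zero_mem _)
      (by rw [map_one]; exact one_mem_barDegree ℋ') hw
    rwa [add_zero] at this
  · rw [deconc_ofBlocks (V := ofBlocks g 0 0 1) h1 h0 (by simp) (by simp) hone (fun x w => by
      rw [ofBlocks_ι_mul _ _ h1 h0, hV])]
    simp
  · exact LinearMap.ext fun w => by rw [LinearMap.comp_apply, counit_ofBlocks, one_mul]
  · rw [proj_ofBlocks 0 1 (s := 0) (by simp)]
    simp

/-- Coalgebra maps that agree on words of length `< n` differ by letters on words of length `n`. -/
theorem IsCoalgebraMap.eq_add_ι {G G' : Bar k H →ₗ[k] Bar k H'} (hG : IsCoalgebraMap ℋ ℋ' G)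
    (hG' : IsCoalgebraMap ℋ ℋ' G') {n : ℕ} (h : ∀ w ∈ lengthLT k H n, G' w = G w)
    {w : Bar k H} (hw : w ∈ lengthLT k H (n + 1)) :
    G' w = G w + TensorAlgebra.ι k (proj k H' (G' w) - proj k H' (G w)) := by
  have h0 : ∀ w ∈ lengthLT k H n, (G' - G) w = 0 := fun w hw => by
    rw [LinearMap.sub_apply, h w hw, sub_self]
  have hp : deconc k H' ((G' - G) w) = (G' - G) w ⊗ₜ 1 + 1 ⊗ₜ (G' - G) w := by
    have e1 := LinearMap.congr_fun hG.comul w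
    have e2 := LinearMap.congr_fun hG'.comul w
    have e3 := map_deconc_of_vanish_left (U := G') h0 hw
    have e4 := map_deconc_of_vanish_right (U := G) h0 hw
    rw [hG'.map_one] at e3
    rw [hG.map_one] at e4
    simp only [LinearMap.comp_apply] at e1 e2
    rw [← e3, ← e4, LinearMap.sub_apply, map_sub, e1, e2, tensorMap_sub_left,
      tensorMap_sub_right, LinearMap.sub_apply, LinearMap.sub_apply]
    abel
  have := eq_ι_of_primitive hp
  rw [LinearMap.sub_apply, map_sub] at this
  rw [← this]
  abel

theorem IsCoalgebraMap.eq_of_proj_eq {G G' : Bar k H →ₗ[k] Bar k H'} (hG : IsCoalgebraMap ℋ ℋ' G)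
    (hG' : IsCoalgebraMap ℋ ℋ' G') {n : ℕ}
    (h : ∀ w ∈ lengthLT k H n, proj k H' (G' w) = proj k H' (G w)) :
    ∀ w ∈ lengthLT k H n, G' w = G w := by
  induction n with
  | zero => intro w hw; rw [lengthLT_zero, Submodule.mem_bot] at hw; simp [hw]
  | succ n ih =>
    intro w hw
    rw [hG.eq_add_ι hG' (ih fun w hw => h w (lengthLT_mono n.le_succ hw)) hw, h w hw]
    simp

theorem map_deconc_congr {M N : Type*} [AddCommGroup M] [Module k M] [AddCommGroup N] [Module k N]
    {X X' : Bar k H →ₗ[k] M} {U U' : Bar k H →ₗ[k] N} {n : ℕ}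
    (hX : ∀ w ∈ lengthLT k H n, X w = X' w) (hU : ∀ w ∈ lengthLT k H n, U w = U' w)
    {w : Bar k H} (hw : w ∈ lengthLT k H n) :
    TensorProduct.map X U (deconc k H w) = TensorProduct.map X' U' (deconc k H w) := by
  induction hw using Submodule.span_induction with
  | mem w hw =>
    obtain ⟨l, hl, rfl⟩ := hw
    rw [deconc_word, map_sum, map_sum]
    refine Finset.sum_congr rfl fun j _ => ?_
    rw [TensorProduct.map_tmul, TensorProduct.map_tmul,
      hX _ (word_mem_lengthLT ((List.length_take_le' j l).trans_lt hl)),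
      hU _ (word_mem_lengthLT (lt_of_le_of_lt (by simp) hl))]
  | zero => simp
  | add a b _ _ ha hb => simp only [map_add, ha, hb]
  | smul c a _ ha => simp only [map_smul, ha]

theorem IsCoalgebraMap.comp {H'' : Type*} [AddCommGroup H''] [Module k H'']
    {ℋ'' : ℤ → Submodule k H''} {G : Bar k H' →ₗ[k] Bar k H''} {F : Bar k H →ₗ[k] Bar k H'}
    (hG : IsCoalgebraMap ℋ' ℋ'' G) (hF : IsCoalgebraMap ℋ ℋ' F) :
    IsCoalgebraMap ℋ ℋ'' (G ∘ₗ F) where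
  map_one := by rw [LinearMap.comp_apply, hF.map_one, hG.map_one]
  degree d w hw := hG.degree d _ (hF.degree d w hw)
  comul := by
    rw [← LinearMap.comp_assoc, hG.comul, LinearMap.comp_assoc, hF.comul, ← LinearMap.comp_assoc,
      ← TensorProduct.map_comp]
  counit := by rw [← LinearMap.comp_assoc, hG.counit, hF.counit]

theorem IsCoalgebraMap.deconc_apply {G : Bar k H →ₗ[k] Bar k H'} (hG : IsCoalgebraMap ℋ ℋ' G)
    (w : Bar k H) : deconc k H' (G w) = TensorProduct.map G G (deconc k H w) :=
  LinearMap.congr_fun hG.comul w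

variable [DirectSum.Decomposition ℋ]

/-- `(K, 1)`-coderivations are freely determined by their letter components. -/
theorem exists_isCoderivation {K : Bar k H →ₗ[k] Bar k H} (hK : IsCoalgebraMap ℋ ℋ K)
    {t : Bar k H →ₗ[k] H} (h1 : t 1 = 0)
    (ht : ∀ d, ∀ w ∈ barDegree ℋ d, t w ∈ ℋ (d + -1)) :
    ∃ T : Bar k H →ₗ[k] Bar k H, IsCoderivation ℋ K T ∧ ∀ w, proj k H (T w) = t w := by
  have hK1 : (K ∘ₗ barSign ℋ) 1 = 1 := by rw [LinearMap.comp_apply, barSign_one, hK.map_one]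
  have hproj : proj k H ((K ∘ₗ barSign ℋ) 1) = 0 := by rw [hK1, proj_one]
  have hc : deconc k H ∘ₗ K ∘ₗ barSign ℋ =
      TensorProduct.map (K ∘ₗ barSign ℋ) (K ∘ₗ barSign ℋ) ∘ₗ deconc k H := by
    rw [← LinearMap.comp_assoc, hK.comul, LinearMap.comp_assoc, deconc_barSign,
      ← LinearMap.comp_assoc, ← TensorProduct.map_comp]
  have hcu : AInfty.counit k H ∘ₗ K ∘ₗ barSign ℋ = AInfty.counit k H := by
    rw [← LinearMap.comp_assoc, hK.counit, counit_barSign]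
  refine ⟨ofBlocks (proj k H ∘ₗ K ∘ₗ barSign ℋ) t LinearMap.id 0, ⟨?_, fun d w hw => ?_, ?_⟩,
    fun w => ?_⟩
  · rw [ofBlocks_one _ _ hproj h1, map_zero]
  · refine ofBlocks_mem (fun d w hw => ?_) ht (fun d w hw => hw) (by simp) hw
    rw [LinearMap.comp_apply, LinearMap.comp_apply, barSign_apply ℋ hw, map_smul, map_smul]
    exact Submodule.smul_mem _ _ (proj_mem (hK.degree d w hw))
  · exact deconc_ofBlocks hproj h1 (by simp) (by simp) hK1
      fun x w => eq_headBlock_of_comul hc hcu hproj x w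
  · rw [proj_ofBlocks LinearMap.id 0 (s := 1) (by simp)]
    simp

/-- Coderivations that agree on words of length `< n` differ by letters on words of length `n`. -/
theorem IsCoderivation.eq_add_ι {K K' T T' : Bar k H →ₗ[k] Bar k H}
    (hK : IsCoalgebraMap ℋ ℋ K)
    (hT : IsCoderivation ℋ K T) (hT' : IsCoderivation ℋ K' T') {n : ℕ}
    (hKK : ∀ w ∈ lengthLT k H n, K' w = K w) (h : ∀ w ∈ lengthLT k H n, T' w = T w)
    {w : Bar k H} (hw : w ∈ lengthLT k H (n + 1)) :
    T' w = T w + TensorAlgebra.ι k (proj k H (T' w) - proj k H (T w)) := by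
  have h0 : ∀ w ∈ lengthLT k H n, (T' - T) w = 0 := fun w hw => by
    rw [LinearMap.sub_apply, h w hw, sub_self]
  have hK0 : ∀ w ∈ lengthLT k H n, (K' ∘ₗ barSign ℋ - K ∘ₗ barSign ℋ) w = 0 := fun w hw => by
    rw [LinearMap.sub_apply, LinearMap.comp_apply, LinearMap.comp_apply,
      hKK _ (barSign_mem_lengthLT ℋ hw), sub_self]
  have hp : deconc k H ((T' - T) w) = (T' - T) w ⊗ₜ 1 + 1 ⊗ₜ (T' - T) w := by
    have e1 := LinearMap.congr_fun hT.comul w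
    have e2 := LinearMap.congr_fun hT'.comul w
    have e3 := map_deconc_of_vanish_left (U := LinearMap.id) h0 hw
    have e4 := map_deconc_of_vanish_right (U := K ∘ₗ barSign ℋ) h0 hw
    have e5 := map_deconc_of_vanish_left (U := T') hK0 hw
    rw [LinearMap.id_apply] at e3
    rw [LinearMap.comp_apply, barSign_one, hK.map_one] at e4
    rw [hT'.map_one, TensorProduct.tmul_zero] at e5
    simp only [LinearMap.comp_apply, LinearMap.add_apply] at e1 e2
    rw [← e3, ← e4, LinearMap.sub_apply, map_sub, e1, e2]
    simp only [tensorMap_sub_left, tensorMap_sub_right, LinearMap.sub_apply] at e5 ⊢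
    rw [sub_eq_zero.mp e5]
    abel
  have := eq_ι_of_primitive hp
  rw [LinearMap.sub_apply, map_sub] at this
  rw [← this]
  abel

theorem IsCoderivation.eq_of_proj_eq {K K' T T' : Bar k H →ₗ[k] Bar k H}
    (hK : IsCoalgebraMap ℋ ℋ K)
    (hT : IsCoderivation ℋ K T) (hT' : IsCoderivation ℋ K' T') {n : ℕ}
    (hKK : ∀ w ∈ lengthLT k H n, K' w = K w)
    (h : ∀ w ∈ lengthLT k H n, proj k H (T' w) = proj k H (T w)) :
    ∀ w ∈ lengthLT k H n, T' w = T w := by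
  induction n with
  | zero => intro w hw; rw [lengthLT_zero, Submodule.mem_bot] at hw; simp [hw]
  | succ n ih =>
    intro w hw
    have h' := fun w hw => hKK w (lengthLT_mono n.le_succ hw)
    rw [hT.eq_add_ι hK hT' h' (ih h' fun w hw => h w (lengthLT_mono n.le_succ hw)) hw, h w hw]
    simp

end CoalgebraMaps

section Approximation

variable {k : Type*} [Field k] {H : Type*} [AddCommGroup H] [Module k H]
  {H' : Type*} [AddCommGroup H'] [Module k H']
  {ℋ : ℤ → Submodule k H} [DirectSum.Decomposition ℋ]
  {ℋ' : ℤ → Submodule k H'} [DirectSum.Decomposition ℋ']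
  {A : AInftyAlgebra ℋ} {A' : AInftyAlgebra ℋ'}

theorem AInftyMorphism.isCoalgebraMap (F : AInftyMorphism A A') : IsCoalgebraMap ℋ ℋ' F.F :=
  ⟨F.F_one, F.degree_zero, F.comul_comp, F.counit_comp⟩

theorem IsCoalgebraMap.barSign_comm {G : Bar k H →ₗ[k] Bar k H'} (hG : IsCoalgebraMap ℋ ℋ' G) :
    barSign ℋ' ∘ₗ G = G ∘ₗ barSign ℋ := by
  refine (barSign_comp_of_degree (ℋ := ℋ) (c := 0) fun d w hw => ?_).trans
    (LinearMap.ext fun w => by simp)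
  rw [add_zero]
  exact hG.degree d w hw

theorem AInftyAlgebra.barSign_comm (A : AInftyAlgebra ℋ) :
    barSign ℋ ∘ₗ A.m = -(A.m ∘ₗ barSign ℋ) :=
  (barSign_comp_of_degree A.degree_one).trans (LinearMap.ext fun w => by simp)

theorem IsCoderivation.barSign_comm {K T : Bar k H →ₗ[k] Bar k H} (hT : IsCoderivation ℋ K T) :
    barSign ℋ ∘ₗ T = -(T ∘ₗ barSign ℋ) :=
  (barSign_comp_of_degree hT.degree).trans (LinearMap.ext fun w => by simp)

theorem AInftyAlgebra.deconc_m (A : AInftyAlgebra ℋ) (w : Bar k H) :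
    deconc k H (A.m w) = TensorProduct.map A.m LinearMap.id (deconc k H w) +
      TensorProduct.map (barSign ℋ) A.m (deconc k H w) :=
  LinearMap.congr_fun A.coderivation w

theorem IsCoderivation.deconc_apply {K T : Bar k H →ₗ[k] Bar k H} (hT : IsCoderivation ℋ K T)
    (w : Bar k H) : deconc k H (T w) = TensorProduct.map (K ∘ₗ barSign ℋ) T (deconc k H w) +
      TensorProduct.map T LinearMap.id (deconc k H w) :=
  LinearMap.congr_fun hT.comul w

theorem tensorMap_map_apply {M N P M' N' P' : Type*} [AddCommGroup M] [Module k M]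
    [AddCommGroup N] [Module k N] [AddCommGroup P] [Module k P] [AddCommGroup M'] [Module k M']
    [AddCommGroup N'] [Module k N'] [AddCommGroup P'] [Module k P']
    (f : N →ₗ[k] P) (f' : N' →ₗ[k] P') (g : M →ₗ[k] N) (g' : M' →ₗ[k] N') (z : M ⊗[k] M') :
    TensorProduct.map f f' (TensorProduct.map g g' z) =
      TensorProduct.map (f ∘ₗ g) (f' ∘ₗ g') z := by
  rw [TensorProduct.map_comp, LinearMap.comp_apply]

theorem tensorMap_neg_left {M N P Q : Type*} [AddCommGroup M] [Module k M] [AddCommGroup N]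
    [Module k N] [AddCommGroup P] [Module k P] [AddCommGroup Q] [Module k Q]
    (f : M →ₗ[k] N) (g : P →ₗ[k] Q) :
    TensorProduct.map (-f) g = -TensorProduct.map f g := by
  rw [← zero_sub, tensorMap_sub_left, TensorProduct.map_zero_left, zero_sub]

/-- The failure of `G` to commute with the codifferentials. -/
def commDefect (A : AInftyAlgebra ℋ) (A' : AInftyAlgebra ℋ') (G : Bar k H' →ₗ[k] Bar k H) :
    Bar k H' →ₗ[k] Bar k H :=
  A.m ∘ₗ G - G ∘ₗ A'.m

/-- The failure of `T` to be a homotopy from the identity to `K`. -/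
def homotopyDefect (A : AInftyAlgebra ℋ) (K T : Bar k H →ₗ[k] Bar k H) : Bar k H →ₗ[k] Bar k H :=
  K - LinearMap.id - (A.m ∘ₗ T + T ∘ₗ A.m)

theorem deconc_commDefect {G : Bar k H' →ₗ[k] Bar k H} (hG : IsCoalgebraMap ℋ' ℋ G)
    (w : Bar k H') : deconc k H (commDefect A A' G w) =
      TensorProduct.map (commDefect A A' G) G (deconc k H' w) +
        TensorProduct.map (G ∘ₗ barSign ℋ') (commDefect A A' G) (deconc k H' w) := by
  simp only [commDefect, LinearMap.sub_apply, LinearMap.comp_apply, map_sub, A.deconc_m,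
    hG.deconc_apply, A'.deconc_m, map_add, tensorMap_map_apply, tensorMap_sub_left,
    tensorMap_sub_right, hG.barSign_comm, LinearMap.id_comp, LinearMap.comp_id]
  abel

theorem deconc_homotopyDefect {K T : Bar k H →ₗ[k] Bar k H} (hK : IsCoalgebraMap ℋ ℋ K)
    (hT : IsCoderivation ℋ K T) (w : Bar k H) :
    deconc k H (homotopyDefect A K T w) =
      TensorProduct.map K (homotopyDefect A K T) (deconc k H w) +
        TensorProduct.map (homotopyDefect A K T) LinearMap.id (deconc k H w) -
        TensorProduct.map (commDefect A A K ∘ₗ barSign ℋ) T (deconc k H w) := by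
  have hS : barSign ℋ ∘ₗ barSign ℋ = LinearMap.id := LinearMap.ext (barSign_barSign ℋ)
  have e1 : barSign ℋ ∘ₗ K ∘ₗ barSign ℋ = K := by
    rw [← LinearMap.comp_assoc, hK.barSign_comm, LinearMap.comp_assoc, hS, LinearMap.comp_id]
  have e2 : (K ∘ₗ barSign ℋ) ∘ₗ A.m = -(K ∘ₗ A.m ∘ₗ barSign ℋ) := by
    rw [LinearMap.comp_assoc, A.barSign_comm, LinearMap.comp_neg]
  have e3 : T ∘ₗ barSign ℋ = -(barSign ℋ ∘ₗ T) := by rw [hT.barSign_comm, neg_neg]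
  have e4 : (K ∘ₗ barSign ℋ) ∘ₗ barSign ℋ = K := by
    rw [LinearMap.comp_assoc, hS, LinearMap.comp_id]
  simp only [homotopyDefect, commDefect, LinearMap.sub_apply, LinearMap.add_apply,
    LinearMap.comp_apply, map_sub, map_add, A.deconc_m, hK.deconc_apply, hT.deconc_apply,
    LinearMap.id_apply, tensorMap_map_apply, tensorMap_sub_left, tensorMap_sub_right,
    TensorProduct.map_add_left, TensorProduct.map_add_right, LinearMap.id_comp, LinearMap.comp_id,
    e1, e2, e3, e4, LinearMap.sub_comp, LinearMap.comp_assoc, tensorMap_neg_left,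
    LinearMap.neg_apply, TensorProduct.map_id]
  abel

/-- `G` is a homotopy inverse of `F`, with homotopy `T`, on words of length `< n`. -/
structure IsInverseUpTo (F : AInftyMorphism A A') (n : ℕ) (G : Bar k H' →ₗ[k] Bar k H)
    (T : Bar k H' →ₗ[k] Bar k H') : Prop where
  coalg : IsCoalgebraMap ℋ' ℋ G
  coder : IsCoderivation ℋ' (F.F ∘ₗ G) T
  comm : ∀ w ∈ lengthLT k H' n, commDefect A A' G w = 0
  homotopy : ∀ w ∈ lengthLT k H' n, homotopyDefect A' (F.F ∘ₗ G) T w = 0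

theorem AInftyMorphism.commDefect_comp (F : AInftyMorphism A A') (G : Bar k H' →ₗ[k] Bar k H) :
    commDefect A' A' (F.F ∘ₗ G) = F.F ∘ₗ commDefect A A' G := by
  rw [commDefect, commDefect, LinearMap.comp_sub, ← LinearMap.comp_assoc, ← F.comm]
  simp only [LinearMap.comp_assoc]

theorem AInftyAlgebra.m_m (A : AInftyAlgebra ℋ) (w : Bar k H) : A.m (A.m w) = 0 :=
  LinearMap.congr_fun A.sq_zero w

theorem m_commDefect (G : Bar k H' →ₗ[k] Bar k H) (w : Bar k H') :
    A.m (commDefect A A' G w) = -commDefect A A' G (A'.m w) := by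
  simp [commDefect, A.m_m, A'.m_m]

theorem m_homotopyDefect (K T : Bar k H →ₗ[k] Bar k H) (w : Bar k H) :
    A.m (homotopyDefect A K T w) =
      homotopyDefect A K T (A.m w) + commDefect A A K w := by
  simp only [homotopyDefect, commDefect, LinearMap.sub_apply, LinearMap.add_apply,
    LinearMap.comp_apply, map_sub, map_add, A.m_m, LinearMap.id_apply, map_zero]
  abel

namespace IsInverseUpTo

variable {F : AInftyMorphism A A'} {n : ℕ} {G : Bar k H' →ₗ[k] Bar k H}
  {T : Bar k H' →ₗ[k] Bar k H'}

theorem commDefect_eq_ι (h : IsInverseUpTo F n G T) {w : Bar k H'}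
    (hw : w ∈ lengthLT k H' (n + 1)) :
    commDefect A A' G w = TensorAlgebra.ι k (proj k H (commDefect A A' G w)) := by
  refine eq_ι_of_primitive ?_
  rw [deconc_commDefect h.coalg, map_deconc_of_vanish_left h.comm hw,
    map_deconc_of_vanish_right h.comm hw, LinearMap.comp_apply, barSign_one, h.coalg.map_one]

theorem homotopyDefect_eq_ι (h : IsInverseUpTo F n G T) {w : Bar k H'}
    (hw : w ∈ lengthLT k H' (n + 1)) :
    homotopyDefect A' (F.F ∘ₗ G) T w =
      TensorAlgebra.ι k (proj k H' (homotopyDefect A' (F.F ∘ₗ G) T w)) := by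
  have hK := F.isCoalgebraMap.comp h.coalg
  refine eq_ι_of_primitive ?_
  have h0 : ∀ w ∈ lengthLT k H' n, (commDefect A' A' (F.F ∘ₗ G) ∘ₗ barSign ℋ') w = 0 :=
    fun w hw => by
      rw [F.commDefect_comp, LinearMap.comp_apply, LinearMap.comp_apply,
        h.comm _ (barSign_mem_lengthLT ℋ' hw), map_zero]
  rw [deconc_homotopyDefect hK h.coder, map_deconc_of_vanish_left h.homotopy hw,
    map_deconc_of_vanish_right h.homotopy hw, map_deconc_of_vanish_left h0 hw, hK.map_one,
    h.coder.map_one, TensorProduct.tmul_zero, sub_zero, add_comm, LinearMap.id_apply]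

end IsInverseUpTo

theorem AInftyAlgebra.m₁_mem (A : AInftyAlgebra ℋ) (i : ℤ) (x : H) (hx : x ∈ ℋ i) :
    A.m₁ x ∈ ℋ (i + 1) :=
  proj_mem (A.degree_one i _ (ι_mem_barDegree hx))

theorem AInftyMorphism.f₁_mem (F : AInftyMorphism A A') (i : ℤ) (x : H) (hx : x ∈ ℋ i) :
    F.f₁ x ∈ ℋ' i :=
  proj_mem (F.degree_zero i _ (ι_mem_barDegree hx))

theorem commDefect_mem {G : Bar k H' →ₗ[k] Bar k H} (hG : IsCoalgebraMap ℋ' ℋ G) {d : ℤ}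
    {w : Bar k H'} (hw : w ∈ barDegree ℋ' d) : commDefect A A' G w ∈ barDegree ℋ (d + 1) :=
  sub_mem (A.degree_one d _ (hG.degree d w hw)) (hG.degree _ _ (A'.degree_one d w hw))

theorem homotopyDefect_mem {K T : Bar k H →ₗ[k] Bar k H} (hK : IsCoalgebraMap ℋ ℋ K)
    (hT : IsCoderivation ℋ K T) {d : ℤ} {w : Bar k H} (hw : w ∈ barDegree ℋ d) :
    homotopyDefect A K T w ∈ barDegree ℋ d := by
  refine sub_mem (sub_mem (hK.degree d w hw) hw) (add_mem ?_ ?_)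
  · simpa using A.degree_one _ _ (hT.degree d w hw)
  · simpa using hT.degree _ _ (A.degree_one d w hw)

/-- A homotopy inverse on words of length `< n` can be corrected on words of length `n`. -/
theorem IsInverseUpTo.exists_succ {F : AInftyMorphism A A'} (hF : F.IsQuasiIso) {n : ℕ}
    {G : Bar k H' →ₗ[k] Bar k H} {T : Bar k H' →ₗ[k] Bar k H'} (h : IsInverseUpTo F n G T) :
    ∃ G' T', IsInverseUpTo F (n + 1) G' T' ∧ (∀ w ∈ lengthLT k H' n, G' w = G w) ∧
      ∀ w ∈ lengthLT k H' n, T' w = T w := by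
  obtain ⟨a, b, c, e, ha, hb, hc, he, h1, h2, h3, h4⟩ := exists_cone_contraction (𝒱 := ℋ)
    (𝒲 := ℋ') (d := A.m₁) (d' := A'.m₁) (f := F.f₁) A.m₁_mem A'.m₁_mem F.f₁_mem A.m₁_m₁ A'.m₁_m₁
    F.f₁_m₁
    (fun v w hv hvw => by
      have := (injective_iff_map_eq_zero _).mp hF.1 (Submodule.Quotient.mk ⟨v, hv⟩) <| by
        refine (Submodule.Quotient.mk_eq_zero _).mpr ?_
        exact ⟨w, hvw.symm⟩
      exact (Submodule.Quotient.mk_eq_zero _).mp this)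
    (fun w hw => by
      obtain ⟨q, hq⟩ := hF.2 (Submodule.Quotient.mk ⟨w, hw⟩)
      obtain ⟨⟨v, hv⟩, rfl⟩ := Submodule.Quotient.mk_surjective _ q
      obtain ⟨w', hw'⟩ := (Submodule.Quotient.eq _).mp hq.symm
      exact ⟨v, w', hv, by
        have : A'.m₁ w' = w - F.f₁ v := hw'
        rw [this]; abel⟩)
  have hK := F.isCoalgebraMap.comp h.coalg
  set ε := proj k H ∘ₗ commDefect A A' G with hε
  set π := proj k H' ∘ₗ homotopyDefect A' (F.F ∘ₗ G) T with hπ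
  have hεd : ∀ d, ∀ w ∈ barDegree ℋ' d, ε w ∈ ℋ (d + 1) := fun d w hw =>
    proj_mem (commDefect_mem h.coalg hw)
  have hπd : ∀ d, ∀ w ∈ barDegree ℋ' d, π w ∈ ℋ' d := fun d w hw =>
    proj_mem (homotopyDefect_mem hK h.coder hw)
  have hε0 : ∀ w ∈ lengthLT k H' n, ε w = 0 := fun w hw => by
    rw [hε, LinearMap.comp_apply, h.comm w hw, map_zero]
  have hπ0 : ∀ w ∈ lengthLT k H' n, π w = 0 := fun w hw => by
    rw [hπ, LinearMap.comp_apply, h.homotopy w hw, map_zero]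
  have hει : ∀ w ∈ lengthLT k H' (n + 1), commDefect A A' G w = TensorAlgebra.ι k (ε w) :=
    fun w hw => h.commDefect_eq_ι hw
  have hπι : ∀ w ∈ lengthLT k H' (n + 1), homotopyDefect A' (F.F ∘ₗ G) T w =
      TensorAlgebra.ι k (π w) := fun w hw => h.homotopyDefect_eq_ι hw
  have hε1 : ε 1 = 0 := by
    simp [hε, commDefect, A'.m_one, h.coalg.map_one, A.m_one]
  have hπ1 : π 1 = 0 := by
    simp [hπ, homotopyDefect, A'.m_one, h.coalg.map_one, F.F_one, h.coder.map_one]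
  -- the pair `(ε, π)` is a cocycle of the mapping cone of `f₁`
  have hεm : ∀ w ∈ lengthLT k H' (n + 1), A.m₁ (ε w) = -ε (A'.m w) := fun w hw => by
    have := m_commDefect (A := A) (A' := A') G w
    rw [hει w hw, hει _ (A'.m_mem_lengthLT hw), A.m_ι, ← map_neg] at this
    exact (TensorAlgebra.ι_inj k _ _).mp this
  have hπm : ∀ w ∈ lengthLT k H' (n + 1), A'.m₁ (π w) = π (A'.m w) + F.f₁ (ε w) := fun w hw => by
    have := m_homotopyDefect (A := A') (F.F ∘ₗ G) T w
    rw [F.commDefect_comp, LinearMap.comp_apply F.F, hει w hw, hπι w hw,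
      hπι _ (A'.m_mem_lengthLT hw), A'.m_ι, F.F_ι, ← map_add] at this
    exact (TensorAlgebra.ι_inj k _ _).mp this
  clear_value ε π
  have hδd : ∀ d, ∀ w ∈ barDegree ℋ' d, (a ∘ₗ ε + b ∘ₗ π) w ∈ ℋ d := fun d w hw =>
    add_mem (by simpa using ha _ _ (hεd d w hw)) (hb _ _ (hπd d w hw))
  have hτd : ∀ d, ∀ w ∈ barDegree ℋ' d, (c ∘ₗ ε + e ∘ₗ π) w ∈ ℋ' (d + -1) := fun d w hw => by
    refine add_mem ?_ (he _ _ (hπd d w hw))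
    have := hc _ _ (hεd d w hw)
    rwa [show d + 1 - 2 = d + -1 by ring] at this
  have hδ0 : ∀ w ∈ lengthLT k H' n, (a ∘ₗ ε + b ∘ₗ π) w = 0 := fun w hw => by
    simp [hε0 w hw, hπ0 w hw]
  have hτ0 : ∀ w ∈ lengthLT k H' n, (c ∘ₗ ε + e ∘ₗ π) w = 0 := fun w hw => by
    simp [hε0 w hw, hπ0 w hw]
  set δ := a ∘ₗ ε + b ∘ₗ π with hδ
  set τ := c ∘ₗ ε + e ∘ₗ π with hτ
  obtain ⟨G', hG', hGp⟩ := exists_isCoalgebraMap (ℋ := ℋ') (ℋ' := ℋ) (g := proj k H ∘ₗ G - δ)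
    (by simp [hδ, hε1, hπ1, h.coalg.map_one, proj_one])
    (fun d w hw => sub_mem (proj_mem (h.coalg.degree d w hw)) (hδd d w hw))
  have hK' := F.isCoalgebraMap.comp hG'
  obtain ⟨T', hT', hTp⟩ := exists_isCoderivation hK' (t := proj k H' ∘ₗ T - τ)
    (by simp [hτ, hε1, hπ1, h.coder.map_one])
    (fun d w hw => sub_mem (proj_mem (h.coder.degree d w hw)) (hτd d w hw))
  have hGG : ∀ w ∈ lengthLT k H' n, G' w = G w := h.coalg.eq_of_proj_eq hG' fun w hw => by
    rw [hGp, LinearMap.sub_apply, hδ0 w hw, sub_zero, LinearMap.comp_apply]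
  have hKK : ∀ w ∈ lengthLT k H' n, (F.F ∘ₗ G') w = (F.F ∘ₗ G) w := fun w hw => by
    rw [LinearMap.comp_apply, hGG w hw, LinearMap.comp_apply]
  have hTT : ∀ w ∈ lengthLT k H' n, T' w = T w := h.coder.eq_of_proj_eq hK hT' hKK fun w hw => by
    rw [hTp, LinearMap.sub_apply, hτ0 w hw, sub_zero, LinearMap.comp_apply]
  have hG2 : ∀ w ∈ lengthLT k H' (n + 1), G' w = G w - TensorAlgebra.ι k (δ w) := fun w hw => by
    rw [h.coalg.eq_add_ι hG' hGG hw, hGp, LinearMap.sub_apply, LinearMap.comp_apply,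
      sub_sub_cancel_left, map_neg, sub_eq_add_neg]
  have hT2 : ∀ w ∈ lengthLT k H' (n + 1), T' w = T w - TensorAlgebra.ι k (τ w) := fun w hw => by
    rw [h.coder.eq_add_ι hK hT' hKK hTT hw, hTp, LinearMap.sub_apply, LinearMap.comp_apply,
      sub_sub_cancel_left, map_neg, sub_eq_add_neg]
  refine ⟨G', T', ⟨hG', hT', fun w hw => ?_, fun w hw => ?_⟩, hGG, hTT⟩
  · have hmw := A'.m_mem_lengthLT hw
    have e1 : commDefect A A' G' w =
        commDefect A A' G w - TensorAlgebra.ι k (A.m₁ (δ w) - δ (A'.m w)) := by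
      simp only [commDefect, LinearMap.sub_apply, LinearMap.comp_apply, hG2 w hw, hG2 _ hmw,
        map_sub, A.m_ι]
      abel
    have e2 : ε (A'.m w) = -A.m₁ (ε w) := by rw [hεm w hw, neg_neg]
    have e3 : π (A'.m w) = A'.m₁ (π w) - F.f₁ (ε w) := by rw [hπm w hw, add_sub_cancel_right]
    have e4 : A.m₁ (δ w) - δ (A'.m w) = ε w := by
      simp only [hδ, LinearMap.add_apply, LinearMap.comp_apply, map_add, map_neg, map_sub, e2, e3]
      linear_combination (norm := abel) h1 (ε w) + h3 (π w)
    rw [e1, hει w hw, e4, sub_self]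
  · have hmw := A'.m_mem_lengthLT hw
    have e1 : homotopyDefect A' (F.F ∘ₗ G') T' w = homotopyDefect A' (F.F ∘ₗ G) T w -
        TensorAlgebra.ι k (F.f₁ (δ w) - A'.m₁ (τ w) - τ (A'.m w)) := by
      simp only [homotopyDefect, LinearMap.sub_apply, LinearMap.add_apply, LinearMap.comp_apply,
        LinearMap.id_apply, hG2 w hw, hT2 w hw, hT2 _ hmw, map_sub, F.F_ι, A'.m_ι]
      abel
    have e2 : ε (A'.m w) = -A.m₁ (ε w) := by rw [hεm w hw, neg_neg]
    have e3 : π (A'.m w) = A'.m₁ (π w) - F.f₁ (ε w) := by rw [hπm w hw, add_sub_cancel_right]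
    have e4 : F.f₁ (δ w) - A'.m₁ (τ w) - τ (A'.m w) = π w := by
      simp only [hδ, hτ, LinearMap.add_apply, LinearMap.comp_apply, map_add, map_neg, map_sub, e2,
        e3]
      linear_combination (norm := abel) h2 (ε w) + h4 (π w)
    rw [e1, hπι w hw, e4, sub_self]

/-- The zeroth approximation of a homotopy inverse. -/
theorem exists_isInverseUpTo_zero (F : AInftyMorphism A A') :
    ∃ (G : Bar k H' →ₗ[k] Bar k H) (T : Bar k H' →ₗ[k] Bar k H'), IsInverseUpTo F 0 G T := by
  obtain ⟨G, hG, -⟩ := exists_isCoalgebraMap (ℋ := ℋ') (ℋ' := ℋ) (g := (0 : Bar k H' →ₗ[k] H))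
    rfl (fun d w _ => zero_mem _)
  obtain ⟨T, hT, -⟩ := exists_isCoderivation (F.isCoalgebraMap.comp hG)
    (t := (0 : Bar k H' →ₗ[k] H')) rfl (fun d w _ => zero_mem _)
  refine ⟨G, T, hG, hT, fun w hw => ?_, fun w hw => ?_⟩ <;>
    rw [lengthLT_zero, Submodule.mem_bot] at hw <;> simp [hw]

/-- A quasi-isomorphism has a homotopy inverse on the level of tensor coalgebras. -/
theorem exists_homotopy_inverse {F : AInftyMorphism A A'} (hF : F.IsQuasiIso) :
    ∃ (G : Bar k H' →ₗ[k] Bar k H) (T : Bar k H' →ₗ[k] Bar k H'),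
      ∀ n, IsInverseUpTo F n G T := by
  choose! gs ts hs hgs hts using fun (n : ℕ) (G : Bar k H' →ₗ[k] Bar k H)
    (T : Bar k H' →ₗ[k] Bar k H') (h : IsInverseUpTo F n G T) => h.exists_succ hF
  obtain ⟨G₀, T₀, h₀⟩ := exists_isInverseUpTo_zero F
  let S : ℕ → (Bar k H' →ₗ[k] Bar k H) × (Bar k H' →ₗ[k] Bar k H') := fun n =>
    Nat.rec (G₀, T₀) (fun n p => (gs n p.1 p.2, ts n p.1 p.2)) n
  have hS : ∀ n, IsInverseUpTo F n (S n).1 (S n).2 := fun n => by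
    induction n with
    | zero => exact h₀
    | succ n ih => exact hs n _ _ ih
  obtain ⟨G, hG⟩ := exists_limit_of_stable (fun n => (S n).1) fun n => hgs n _ _ (hS n)
  obtain ⟨T, hT⟩ := exists_limit_of_stable (fun n => (S n).2) fun n => hts n _ _ (hS n)
  have hG1 : G 1 = 1 := by
    rw [hG 1 1 (one_mem_lengthLT 0)]; exact (hS 1).coalg.map_one
  have hco : IsCoalgebraMap ℋ' ℋ G := by
    refine ⟨hG1, fun d w hw => ?_, LinearMap.ext fun w => ?_, LinearMap.ext fun w => ?_⟩ <;>
      obtain ⟨n, hn⟩ := exists_mem_lengthLT w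
    · rw [hG n w hn]; exact (hS n).coalg.degree d w hw
    · rw [LinearMap.comp_apply, LinearMap.comp_apply, hG n w hn, (hS n).coalg.deconc_apply,
        map_deconc_congr (hG n) (hG n) hn]
    · rw [LinearMap.comp_apply, hG n w hn]; exact LinearMap.congr_fun (hS n).coalg.counit w
  have hcd : IsCoderivation ℋ' (F.F ∘ₗ G) T := by
    refine ⟨?_, fun d w hw => ?_, LinearMap.ext fun w => ?_⟩
    · rw [hT 1 1 (one_mem_lengthLT 0)]; exact (hS 1).coder.map_one
    · obtain ⟨n, hn⟩ := exists_mem_lengthLT w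
      rw [hT n w hn]; exact (hS n).coder.degree d w hw
    · obtain ⟨n, hn⟩ := exists_mem_lengthLT w
      have hK : ∀ w ∈ lengthLT k H' n, ((F.F ∘ₗ G) ∘ₗ barSign ℋ') w =
          ((F.F ∘ₗ (S n).1) ∘ₗ barSign ℋ') w := fun w hw => by
        simp only [LinearMap.comp_apply, hG n _ (barSign_mem_lengthLT ℋ' hw)]
      rw [LinearMap.comp_apply, LinearMap.add_apply, LinearMap.comp_apply, LinearMap.comp_apply,
        hT n w hn, (hS n).coder.deconc_apply, map_deconc_congr hK (hT n) hn,
        map_deconc_congr (hT n) (fun _ _ => rfl) hn]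
  refine ⟨G, T, fun n => ⟨hco, hcd, fun w hw => ?_, fun w hw => ?_⟩⟩
  · rw [← (hS n).comm w hw]
    simp only [commDefect, LinearMap.sub_apply, LinearMap.comp_apply, hG n w hw,
      hG n _ (A'.m_mem_lengthLT hw)]
  · rw [← (hS n).homotopy w hw]
    simp only [homotopyDefect, LinearMap.sub_apply, LinearMap.add_apply, LinearMap.comp_apply,
      LinearMap.id_apply, hG n w hw, hT n w hw, hT n _ (A'.m_mem_lengthLT hw)]

/-- A quasi-isomorphism has an `A∞`-morphism in the opposite direction as a right inverse up to
homotopy. -/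
theorem exists_morphism_homotopy {F : AInftyMorphism A A'} (hF : F.IsQuasiIso) :
    ∃ (G : AInftyMorphism A' A) (t : H' →ₗ[k] H'),
      ∀ x, F.f₁ (G.f₁ x) = x + A'.m₁ (t x) + t (A'.m₁ x) := by
  obtain ⟨G, T, h⟩ := exists_homotopy_inverse hF
  have hcomm : G ∘ₗ A'.m = A.m ∘ₗ G := LinearMap.ext fun w => by
    obtain ⟨n, hn⟩ := exists_mem_lengthLT w
    exact (sub_eq_zero.mp ((h n).comm w hn)).symm
  let G' : AInftyMorphism A' A :=
    { F := G
      degree_zero := (h 0).coalg.degree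
      comul_comp := (h 0).coalg.comul
      counit_comp := (h 0).coalg.counit
      comm := hcomm
      f_zero := by
        ext v
        simp [component, TensorAlgebra.tprod_apply, (h 0).coalg.map_one, proj_one] }
  have hTι (x : H') : T (TensorAlgebra.ι k x) = TensorAlgebra.ι k (linearPart T x) := by
    refine eq_ι_of_primitive ?_
    rw [(h 0).coder.deconc_apply, deconc_ι]
    simp [(h 0).coder.map_one, barSign_one, (h 0).coalg.map_one, F.F_one, add_comm]
  refine ⟨G', linearPart T, fun x => ?_⟩
  have h2 := (h 2).homotopy (TensorAlgebra.ι k x) (ι_mem_lengthLT 0 x)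
  have hGι : G (TensorAlgebra.ι k x) = TensorAlgebra.ι k (G'.f₁ x) := G'.F_ι x
  simp only [homotopyDefect, LinearMap.sub_apply, LinearMap.add_apply, LinearMap.comp_apply,
    LinearMap.id_apply, A'.m_ι, hTι, hGι, F.F_ι, ← map_sub, ← map_add] at h2
  have h3 := (TensorAlgebra.ι_eq_zero_iff k _).mp h2
  rw [sub_sub, sub_eq_zero] at h3
  rw [h3, add_assoc]

end Approximation

end AInfty

end

theorem theorem4p11 {k : Type*} [Field k] [CharZero k]
    {H : Type*} [AddCommGroup H] [Module k H] (ℋ : ℤ → Submodule k H) [DirectSum.Decomposition ℋ]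
    {H' : Type*} [AddCommGroup H'] [Module k H'] (ℋ' : ℤ → Submodule k H')
    [DirectSum.Decomposition ℋ']
    (A : AInfty.AInftyAlgebra ℋ) (A' : AInfty.AInftyAlgebra ℋ')
    (F : AInfty.AInftyMorphism A A') (hF : F.IsQuasiIso) :
    ∃ G : AInfty.AInftyMorphism A' A, G.IsQuasiIso ∧
      G.cohomologyMap ∘ₗ F.cohomologyMap = LinearMap.id ∧
      F.cohomologyMap ∘ₗ G.cohomologyMap = LinearMap.id := by
  obtain ⟨G, t, hG⟩ := AInfty.exists_morphism_homotopy hF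
  have hFG : ∀ q, F.cohomologyMap (G.cohomologyMap q) = q := fun q => by
    obtain ⟨⟨x, hx⟩, rfl⟩ := Submodule.Quotient.mk_surjective _ q
    refine (Submodule.Quotient.eq _).mpr ⟨t x, ?_⟩
    rw [LinearMap.mem_ker] at hx
    change A'.m₁ (t x) = F.f₁ (G.f₁ x) - x
    rw [hG, hx, map_zero]
    abel
  have hGF : ∀ q, G.cohomologyMap (F.cohomologyMap q) = q := fun q => hF.1 (hFG _)
  exact ⟨G, Function.bijective_iff_has_inverse.mpr ⟨_, hFG, hGF⟩, LinearMap.ext hGF,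
    LinearMap.ext hFG⟩
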